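/- Let $p$ be a prime, $n\ge 0$ an integer, and $H$ a separable complex Hilbert space. For $1\le q<\infty$ let $\mathcal S_q$ be the Schatten class of compact operators $A$ on $H$ with $\|A\|_q=\left(\sum_k s_k(A)^q\right)^{1/q}<\infty$, where $s_k(A)$ are the singular values of $A$ (the square roots of the nonzero eigenvalues of $A^*A$, repeated according to multiplicity); it is a Banach space under $\|\cdot\|_q$. Let $\mu$ be the Haar measure on $\mathbb Q_p^n$ normalized by $\mu(\mathbb Z_p^n)=1$. For $x=\sum_{i\ge\gamma}x_ip^i\in\mathbb Q_p$ with digits $x_i\in\{0,\dots,p-1\}$, let $\{x\}_p=\sum_{\gamma\le i<0}x_ip^i$ be its fractional part. Let $1\le q\le 2$ and let $A\in L^1(\mathbb Q_p^n,\mu;\mathcal S_q)\cap L^2(\mathbb Q_p^n,\mu;\mathcal S_q)$ (Bochner spaces). Then for every $\xi\in\mathbb Q_p^n$ the Bochner integral $$B_\xi=\int_{\mathbb Q_p^n}e^{-2\pi i\{\xi_1\theta_1+\dots+\xi_n\theta_n\}_p}A_\theta\,d\mu(\theta)\in\mathcal S_q$$ is well defined. If $q>1$ and $r=q/(q-1)$,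 then $B\in L^r(\mathbb Q_p^n,\mu;\mathcal S_q)$ and $$\int_{\mathbb Q_p^n}\|B_\xi\|_q^r\,d\mu(\xi)\le\left(\int_{\mathbb Q_p^n}\|A_\theta\|_q^q\,d\mu(\theta)\right)^{r/q}.$$ If $q=1$ (so that $r=\infty$), then $B\in L^\infty(\mathbb Q_p^n,\mu;\mathcal S_1)$ and $$\sup_{\xi\in\mathbb Q_p^n}\|B_\xi\|_1\le\int_{\mathbb Q_p^n}\|A_\theta\|_1\,d\mu(\theta).$$ -/

import Mathlib

open MeasureTheory
open scoped ENNReal InnerProductSpace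

noncomputable section

open Module.End

variable {H : Type*} [NormedAddCommGroup H] [InnerProductSpace ℂ H] [CompleteSpace H]

/-- The multiplicity of `s > 0` as a singular value of `A`, i.e. the dimension of the eigenspace
of `A* A` for the eigenvalue `s ^ 2`. -/
def singularMultiplicity (A : H →L[ℂ] H) (s : ℝ) : ℕ :=
  Module.finrank ℂ (eigenspace (A.adjoint ∘L A).toLinearMap ((s ^ 2 : ℝ) : ℂ))

/-- `tr (|A| ^ q)`: the sum of the `q`-th powers of the singular values of `A`, each one repeated
according to its multiplicity. Meant for compact `A` (all multiplicities are then finite). -/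
def schattenSum (q : ℝ) (A : H →L[ℂ] H) : ℝ≥0∞ :=
  ∑' s : Set.Ioi (0 : ℝ), (singularMultiplicity A s : ℝ≥0∞) * ENNReal.ofReal ((s : ℝ) ^ q)

theorem adjoint_comp_self_symm (A : H →L[ℂ] H) : (A.adjoint ∘L A).IsSymmetric := by
  intro x y
  simp [ContinuousLinearMap.adjoint_inner_left, ContinuousLinearMap.adjoint_inner_right]

/-- The singular value decomposition of a compact operator, with the singular values listed
according to multiplicity. -/
theorem exists_singular_system {A : H →L[ℂ] H} (hA : IsCompactOperator A) (q : ℝ) :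
    ∃ (ι : Type) (u v : ι → H) (s : ι → ℝ), Orthonormal ℂ u ∧ Orthonormal ℂ v ∧ (∀ i, 0 < s i) ∧
      (∀ i, A (u i) = (s i : ℂ) • v i) ∧ (∀ x, (∀ i, ⟪u i, x⟫_ℂ = 0) → A x = 0) ∧
      schattenSum q A = ∑' i, ENNReal.ofReal (s i ^ q) := by
  set T : H →L[ℂ] H := A.adjoint ∘L A with hT
  have hsymm : T.IsSymmetric := adjoint_comp_self_symm A
  have hTc : IsCompactOperator T := hA.clm_comp A.adjoint
  have hTi : ∀ x y, ⟪A x, A y⟫_ℂ = ⟪x, T y⟫_ℂ := by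
    intro x y; simp [hT, ContinuousLinearMap.adjoint_inner_right]
  have hfin : ∀ s : Set.Ioi (0 : ℝ),
      FiniteDimensional ℂ (eigenspace T.toLinearMap (((s : ℝ) ^ 2 : ℝ) : ℂ)) := by
    intro s
    apply ContinuousLinearMap.finite_dimensional_eigenspace hTc
    have : (0 : ℝ) < s := s.2
    exact_mod_cast (by positivity : ((s : ℝ) ^ 2) ≠ 0)
  let b := fun s : Set.Ioi (0 : ℝ) =>
    stdOrthonormalBasis ℂ (eigenspace T.toLinearMap (((s : ℝ) ^ 2 : ℝ) : ℂ))
  let ι := Σ s : Set.Ioi (0 : ℝ), Fin (singularMultiplicity A s)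
  let u : ι → H := fun i => (b i.1 i.2 : H)
  let s : ι → ℝ := fun i => i.1
  have hspos : ∀ i, 0 < s i := fun i => i.1.2
  have hinj : Function.Injective (fun s : Set.Ioi (0 : ℝ) => (((s : ℝ) ^ 2 : ℝ) : ℂ)) := by
    intro x y hxy
    have h1 : ((x : ℝ) ^ 2) = (y : ℝ) ^ 2 := Complex.ofReal_injective hxy
    exact Subtype.ext ((pow_left_inj₀ (le_of_lt x.2) (le_of_lt y.2) two_ne_zero).1 h1)
  have hu : Orthonormal ℂ u :=
    (hsymm.orthogonalFamily_eigenspaces.comp hinj).orthonormal_sigma_orthonormal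
      (fun s => (b s).orthonormal)
  have hTu : ∀ i, T (u i) = ((s i ^ 2 : ℝ) : ℂ) • u i := fun i =>
    mem_eigenspace_iff.1 (b i.1 i.2).2
  refine ⟨ι, u, fun i => ((s i)⁻¹ : ℂ) • A (u i), s, hu, ?_, hspos, ?_, ?_, ?_⟩
  · classical
    rw [orthonormal_iff_ite] at hu ⊢
    intro i j
    have hi : (s i : ℂ) ≠ 0 := by exact_mod_cast (hspos i).ne'
    rw [inner_smul_left, inner_smul_right, hTi, hTu, inner_smul_right, hu]
    split_ifs with h
    · subst h
      simp only [map_inv₀, Complex.conj_ofReal, Complex.ofReal_pow]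
      field_simp
    · simp
  · intro i
    have hi : (s i : ℂ) ≠ 0 := by exact_mod_cast (hspos i).ne'
    simp [smul_smul, hi]
  · intro x hx
    have hTx : T x ∈ (⨆ μ, eigenspace (T : Module.End ℂ H) μ)ᗮ := by
      rw [← Submodule.iInf_orthogonal, Submodule.mem_iInf]
      intro μ
      rw [Submodule.mem_orthogonal]
      intro y hy
      have hTy : T y = μ • y := mem_eigenspace_iff.1 hy
      have hswap : ⟪y, T x⟫_ℂ = ⟪T y, x⟫_ℂ := (hsymm y x).symm
      rw [hswap, hTy, inner_smul_left]
      by_cases hμ : μ = 0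
      · simp [hμ]
      by_cases hy0 : y = 0
      · simp [hy0]
      have hyn : (0 : ℝ) < ‖y‖ := norm_pos_iff.2 hy0
      have h1 : ((‖A y‖ : ℂ)) ^ 2 = μ * (‖y‖ : ℂ) ^ 2 := by
        have := hTi y y
        rwa [hTy, inner_smul_right, inner_self_eq_norm_sq_to_K,
          inner_self_eq_norm_sq_to_K] at this
      have h2 : μ = ((‖A y‖ / ‖y‖ : ℝ) ^ 2 : ℝ) := by
        have : (‖y‖ : ℂ) ≠ 0 := by exact_mod_cast hyn.ne'
        push_cast
        field_simp
        exact h1.symm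
      have hpos : 0 < ‖A y‖ / ‖y‖ := by
        refine lt_of_le_of_ne (by positivity) fun h => hμ ?_
        rw [h2, ← h]; simp
      let t : Set.Ioi (0 : ℝ) := ⟨_, hpos⟩
      have hyt : y ∈ eigenspace T.toLinearMap (((t : ℝ) ^ 2 : ℝ) : ℂ) := by
        rw [← h2]; exact hy
      have h3 := (b t).sum_repr' ⟨y, hyt⟩
      have h4 : y = ∑ j, ⟪b t j, ⟨y, hyt⟩⟫_ℂ • ((b t j : _) : H) := by
        have := congrArg Subtype.val h3
        simpa using this.symm
      have h5 : ⟪y, x⟫_ℂ = 0 := by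
        rw [h4, sum_inner]
        refine Finset.sum_eq_zero fun j _ => ?_
        rw [inner_smul_left]
        have : ⟪((b t j : _) : H), x⟫_ℂ = 0 := hx ⟨t, j⟩
        rw [this, mul_zero]
      rw [h5, mul_zero]
    rw [ContinuousLinearMap.orthogonalComplement_iSup_eigenspaces_eq_bot hTc hsymm,
      Submodule.mem_bot] at hTx
    have := hTi x x
    rw [hTx, inner_zero_right] at this
    exact inner_self_eq_zero.1 this
  · rw [schattenSum, ENNReal.tsum_sigma']
    simp [s]

theorem hasSum_inner_singular {A : H →L[ℂ] H} {ι : Type} {u v : ι → H} {s : ι → ℝ}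
    (hu : Orthonormal ℂ u) (hAu : ∀ i, A (u i) = (s i : ℂ) • v i)
    (hker : ∀ x, (∀ i, ⟪u i, x⟫_ℂ = 0) → A x = 0) (e f : H) :
    HasSum (fun i => ⟪u i, e⟫_ℂ * ((s i : ℂ) * ⟪f, v i⟫_ℂ)) ⟪f, A e⟫_ℂ := by
  obtain ⟨w, b, hw, hb⟩ := hu.toSubtypeRange.exists_hilbertBasis_extension
  have h1 := (b.hasSum_repr e).mapL ((innerSL ℂ f).comp A)
  let g : ι → w := fun i => ⟨u i, hw (Set.mem_range_self i)⟩
  have hg : Function.Injective g := fun i j h =>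
    hu.linearIndependent.injective (congrArg Subtype.val h)
  rw [← hg.hasSum_iff] at h1
  · have h2 : (fun i => ⟪u i, e⟫_ℂ * ((s i : ℂ) * ⟪f, v i⟫_ℂ)) =
        (fun j => ((innerSL ℂ f).comp A) (b.repr e j • b j)) ∘ g := by
      funext i
      have : b (g i) = u i := by rw [hb]
      rw [Function.comp_apply, HilbertBasis.repr_apply_apply, this, map_smul, smul_eq_mul,
        ContinuousLinearMap.comp_apply, innerSL_apply_apply, hAu, inner_smul_right]
    rw [h2]
    exact h1
  · intro x hx
    have : A (b x) = 0 := by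
      apply hker
      intro i
      have h2 : u i = b (g i) := by rw [hb]
      rw [h2]
      exact b.orthonormal.2 (fun h => hx ⟨i, h⟩)
    simp [this]

theorem bessel_mix {E ι : Type*} [NormedAddCommGroup E] [InnerProductSpace ℂ E]
    {a c : ι → E} (ha : Orthonormal ℂ a) (hc : Orthonormal ℂ c)
    {x y : E} (hx : ‖x‖ = 1) (hy : ‖y‖ = 1) (F : Finset ι) :
    ∑ i ∈ F, ‖⟪a i, x⟫_ℂ‖ * ‖⟪c i, y⟫_ℂ‖ ≤ 1 := by
  have h1 : ∑ i ∈ F, ‖⟪a i, x⟫_ℂ‖ ^ 2 ≤ ‖x‖ ^ 2 := ha.sum_inner_products_le x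
  have h2 : ∑ i ∈ F, ‖⟪c i, y⟫_ℂ‖ ^ 2 ≤ ‖y‖ ^ 2 := hc.sum_inner_products_le y
  have h3 : ∑ i ∈ F, ‖⟪a i, x⟫_ℂ‖ * ‖⟪c i, y⟫_ℂ‖ ≤
      ∑ i ∈ F, (‖⟪a i, x⟫_ℂ‖ ^ 2 + ‖⟪c i, y⟫_ℂ‖ ^ 2) / 2 :=
    Finset.sum_le_sum fun i _ => by nlinarith [sq_nonneg (‖⟪a i, x⟫_ℂ‖ - ‖⟪c i, y⟫_ℂ‖)]
  rw [← Finset.sum_div, Finset.sum_add_distrib] at h3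
  rw [hx] at h1; rw [hy] at h2
  linarith

theorem tsum_weight_rpow_le {ι : Type*} {q : ℝ} (hq : 1 ≤ q) (w t : ι → ℝ≥0∞)
    (hw : ∀ F : Finset ι, ∑ i ∈ F, w i ≤ 1) :
    (∑' i, w i * t i) ^ q ≤ ∑' i, w i * t i ^ q := by
  have hq0 : 0 < q := by linarith
  rw [← ENNReal.le_rpow_inv_iff hq0, ENNReal.tsum_eq_iSup_sum]
  refine iSup_le fun F => ?_
  refine (ENNReal.inner_le_weight_mul_Lp_of_nonneg F hq w t).trans ?_
  calc _ ≤ 1 * (∑' i, w i * t i ^ q) ^ q⁻¹ := by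
        gcongr
        · exact ENNReal.rpow_le_one (hw F) (by have := inv_le_one_of_one_le₀ hq; linarith)
        · exact ENNReal.sum_le_tsum F
    _ = _ := one_mul _

theorem sum_inner_rpow_le_schattenSum {q : ℝ} (hq : 1 ≤ q) {A : H →L[ℂ] H}
    (hA : IsCompactOperator A) {κ : Type*} [Fintype κ] {e f : κ → H} (he : Orthonormal ℂ e)
    (hf : Orthonormal ℂ f) : ∑ k, ‖⟪f k, A (e k)⟫_ℂ‖ₑ ^ q ≤ schattenSum q A := by
  obtain ⟨ι, u, v, s, hu, hv, hs, hAu, hker, hsum⟩ := exists_singular_system hA q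
  have hq0 : 0 ≤ q := by linarith
  let w : κ → ι → ℝ≥0∞ := fun k i => ‖⟪u i, e k⟫_ℂ‖ₑ * ‖⟪v i, f k⟫_ℂ‖ₑ
  have hwreal : ∀ k i, w k i = ENNReal.ofReal (‖⟪u i, e k⟫_ℂ‖ * ‖⟪v i, f k⟫_ℂ‖) := by
    intro k i
    rw [ENNReal.ofReal_mul (norm_nonneg _), ofReal_norm, ofReal_norm]
  have hrow : ∀ k (F : Finset ι), ∑ i ∈ F, w k i ≤ 1 := by
    intro k F
    simp_rw [hwreal]
    rw [← ENNReal.ofReal_sum_of_nonneg (fun i _ => by positivity), ENNReal.ofReal_le_one]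
    exact bessel_mix hu hv (he.1 k) (hf.1 k) F
  have hcol : ∀ i, ∑ k, w k i ≤ 1 := by
    intro i
    simp_rw [hwreal]
    rw [← ENNReal.ofReal_sum_of_nonneg (fun i _ => by positivity), ENNReal.ofReal_le_one]
    simp_rw [norm_inner_symm (u i), norm_inner_symm (v i)]
    exact bessel_mix he hf (hu.1 i) (hv.1 i) Finset.univ
  calc ∑ k, ‖⟪f k, A (e k)⟫_ℂ‖ₑ ^ q
      ≤ ∑ k, (∑' i, w k i * ENNReal.ofReal (s i)) ^ q := by
        refine Finset.sum_le_sum fun k _ => ENNReal.rpow_le_rpow ?_ hq0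
        rw [← (hasSum_inner_singular hu hAu hker (e k) (f k)).tsum_eq]
        refine enorm_tsum_le_tsum_enorm.trans (ENNReal.tsum_le_tsum fun i => le_of_eq ?_)
        have h1 : ‖((s i : ℝ) : ℂ)‖ₑ = ENNReal.ofReal (s i) := by
          rw [← ofReal_norm, Complex.norm_real, Real.norm_of_nonneg (hs i).le]
        have h2 : ‖⟪f k, v i⟫_ℂ‖ₑ = ‖⟪v i, f k⟫_ℂ‖ₑ := by
          rw [← ofReal_norm, ← ofReal_norm, norm_inner_symm]
        rw [enorm_mul, enorm_mul, h1, h2]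
        ring
    _ ≤ ∑ k, ∑' i, w k i * ENNReal.ofReal (s i) ^ q :=
        Finset.sum_le_sum fun k _ => tsum_weight_rpow_le hq _ _ (hrow k)
    _ = ∑' i, ∑ k, w k i * ENNReal.ofReal (s i) ^ q := by
        rw [Summable.tsum_finsetSum fun _ _ => ENNReal.summable]
    _ ≤ ∑' i, ENNReal.ofReal (s i ^ q) := by
        refine ENNReal.tsum_le_tsum fun i => ?_
        rw [← Finset.sum_mul, ENNReal.ofReal_rpow_of_nonneg (hs i).le hq0]
        exact mul_le_of_le_one_left zero_le (hcol i)
    _ = schattenSum q A := hsum.symm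

theorem schattenSum_le_of_forall {q : ℝ} (hq : 1 ≤ q) {A : H →L[ℂ] H}
    (hA : IsCompactOperator A) {C : ℝ≥0∞}
    (h : ∀ (m : ℕ) (e f : Fin m → H), Orthonormal ℂ e → Orthonormal ℂ f →
      ∑ k, ‖⟪f k, A (e k)⟫_ℂ‖ₑ ^ q ≤ C) : schattenSum q A ≤ C := by
  obtain ⟨ι, u, v, s, hu, hv, hs, hAu, hker, hsum⟩ := exists_singular_system hA q
  have hq0 : 0 ≤ q := by linarith
  rw [hsum, ENNReal.tsum_eq_iSup_sum]
  refine iSup_le fun F => ?_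
  let g : Fin F.card → ι := fun j => F.equivFin.symm j
  have hg : Function.Injective g := Subtype.val_injective.comp F.equivFin.symm.injective
  refine le_trans (le_of_eq ?_) (h F.card (u ∘ g) (v ∘ g) (hu.comp g hg) (hv.comp g hg))
  rw [← Finset.sum_coe_sort, ← F.equivFin.symm.sum_comp]
  refine Finset.sum_congr rfl fun j _ => ?_
  have h1 : ‖((s (g j) : ℝ) : ℂ)‖ₑ = ENNReal.ofReal (s (g j)) := by
    rw [← ofReal_norm, Complex.norm_real, Real.norm_of_nonneg (hs _).le]
  rw [← ENNReal.ofReal_rpow_of_nonneg (hs _).le hq0]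
  have h2 : ⟪v (g j), v (g j)⟫_ℂ = 1 := by
    rw [inner_self_eq_norm_sq_to_K, hv.1]; simp
  simp only [Function.comp_apply, hAu, inner_smul_right, h2, mul_one, h1]
  rfl

theorem schattenSum_add_rpow_le {q : ℝ} (hq : 1 ≤ q) {A B : H →L[ℂ] H}
    (hA : IsCompactOperator A) (hB : IsCompactOperator B) :
    schattenSum q (A + B) ^ (1 / q) ≤ schattenSum q A ^ (1 / q) + schattenSum q B ^ (1 / q) := by
  have hq0 : 0 < q := by linarith
  rw [one_div, ENNReal.rpow_inv_le_iff hq0, ← one_div]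
  refine schattenSum_le_of_forall hq (hA.add hB) fun m e f he hf => ?_
  rw [← ENNReal.rpow_inv_le_iff hq0, ← one_div]
  calc (∑ k, ‖⟪f k, (A + B) (e k)⟫_ℂ‖ₑ ^ q) ^ (1 / q)
      ≤ (∑ k, (‖⟪f k, A (e k)⟫_ℂ‖ₑ + ‖⟪f k, B (e k)⟫_ℂ‖ₑ) ^ q) ^ (1 / q) := by
        gcongr with k _
        rw [add_apply, inner_add_right]
        exact enorm_add_le _ _
    _ ≤ (∑ k, ‖⟪f k, A (e k)⟫_ℂ‖ₑ ^ q) ^ (1 / q) + (∑ k, ‖⟪f k, B (e k)⟫_ℂ‖ₑ ^ q) ^ (1 / q) :=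
        ENNReal.Lp_add_le _ _ _ hq
    _ ≤ _ := by
        gcongr
        · exact sum_inner_rpow_le_schattenSum hq hA he hf
        · exact sum_inner_rpow_le_schattenSum hq hB he hf

theorem schattenSum_smul_le {q : ℝ} (hq : 1 ≤ q) {A : H →L[ℂ] H}
    (hA : IsCompactOperator A) (c : ℂ) :
    schattenSum q (c • A) ≤ ‖c‖ₑ ^ q * schattenSum q A := by
  refine schattenSum_le_of_forall hq (hA.smul c) fun m e f he hf => ?_
  calc ∑ k, ‖⟪f k, (c • A) (e k)⟫_ℂ‖ₑ ^ q = ‖c‖ₑ ^ q * ∑ k, ‖⟪f k, A (e k)⟫_ℂ‖ₑ ^ q := by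
        rw [Finset.mul_sum]
        refine Finset.sum_congr rfl fun k _ => ?_
        rw [smul_apply, inner_smul_right, enorm_mul,
          ENNReal.mul_rpow_of_nonneg _ _ (by linarith)]
    _ ≤ _ := by
        gcongr
        exact sum_inner_rpow_le_schattenSum hq hA he hf

theorem schattenSum_zero {q : ℝ} (hq : 1 ≤ q) : schattenSum q (0 : H →L[ℂ] H) = 0 := by
  refine le_antisymm (schattenSum_le_of_forall hq isCompactOperator_zero fun m e f _ _ => ?_)
    zero_le
  simp [show (0 : ℝ) < q by linarith]

theorem enorm_le_schattenSum_rpow {q : ℝ} (hq : 1 ≤ q) {A : H →L[ℂ] H}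
    (hA : IsCompactOperator A) : ‖A‖ₑ ≤ schattenSum q A ^ (1 / q) := by
  have hq0 : 0 < q := by linarith
  by_cases htop : schattenSum q A = ∞
  · rw [htop, ENNReal.top_rpow_of_pos (by positivity)]; exact le_top
  have hfin : schattenSum q A ^ (1 / q) ≠ ∞ := ENNReal.rpow_ne_top_of_nonneg (by positivity) htop
  rw [← ofReal_norm, ENNReal.ofReal_le_iff_le_toReal hfin]
  refine ContinuousLinearMap.opNorm_le_of_re_inner_le ENNReal.toReal_nonneg fun x y hx hy => ?_
  have hx' : Orthonormal ℂ (fun _ : Unit => x) :=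
    ⟨fun _ => hx, fun i j h => (h (Subsingleton.elim i j)).elim⟩
  have hy' : Orthonormal ℂ (fun _ : Unit => y) :=
    ⟨fun _ => hy, fun i j h => (h (Subsingleton.elim i j)).elim⟩
  have h := sum_inner_rpow_le_schattenSum hq hA hx' hy'
  rw [Fintype.sum_unique, ← ENNReal.le_rpow_inv_iff hq0, ← one_div, ← ofReal_norm,
    ENNReal.ofReal_le_iff_le_toReal hfin, norm_inner_symm] at h
  exact (RCLike.re_le_norm _).trans h

variable (H) in
/-- The linear space of compact operators `A` on `H` with `tr (|A| ^ q) < ∞`. -/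
def schattenSubmodule (q : ℝ) [hq : Fact (1 ≤ q)] : Submodule ℂ (H →L[ℂ] H) where
  carrier := {A | IsCompactOperator A ∧ schattenSum q A < ∞}
  zero_mem' := ⟨isCompactOperator_zero, by simp [schattenSum_zero hq.out]⟩
  add_mem' := by
    rintro A B ⟨hA, hA'⟩ ⟨hB, hB'⟩
    have hq0 : 0 < q := by linarith [hq.out]
    refine ⟨hA.add hB, ?_⟩
    have h := schattenSum_add_rpow_le hq.out hA hB
    by_contra htop
    rw [not_lt, top_le_iff] at htop
    rw [htop, ENNReal.top_rpow_of_pos (by positivity), top_le_iff, ENNReal.add_eq_top] at h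
    rcases h with h | h
    · exact ENNReal.rpow_ne_top_of_nonneg (by positivity) hA'.ne h
    · exact ENNReal.rpow_ne_top_of_nonneg (by positivity) hB'.ne h
  smul_mem' := by
    rintro c A ⟨hA, hA'⟩
    refine ⟨hA.smul c, (schattenSum_smul_le hq.out hA c).trans_lt ?_⟩
    exact ENNReal.mul_lt_top
      (ENNReal.rpow_lt_top_of_nonneg (by linarith [hq.out]) enorm_ne_top) hA'

variable (H) in
/-- The Schatten ideal `S_q` of operators on `H`, for `1 ≤ q < ∞`, as a type of its own, so that
it carries the Schatten norm and not the operator norm. -/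
def SchattenClass (q : ℝ) [Fact (1 ≤ q)] : Type _ := schattenSubmodule H q

namespace SchattenClass

variable {q : ℝ} [hq : Fact (1 ≤ q)]

instance instAddCommGroup : AddCommGroup (SchattenClass H q) :=
  inferInstanceAs (AddCommGroup (schattenSubmodule H q))

instance instModule : Module ℂ (SchattenClass H q) := inferInstanceAs (Module ℂ (schattenSubmodule H q))

variable (H q) in
/-- The inclusion of `S_q` into the bounded operators. -/
def toOp : SchattenClass H q →ₗ[ℂ] (H →L[ℂ] H) := (schattenSubmodule H q).subtype

theorem toOp_injective : Function.Injective (toOp H q) := (schattenSubmodule H q).injective_subtype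

theorem isCompactOperator (A : SchattenClass H q) : IsCompactOperator (toOp H q A) := A.2.1

theorem schattenSum_ne_top (A : SchattenClass H q) : schattenSum q (toOp H q A) ≠ ∞ := A.2.2.ne

/-- The Schatten norm `‖A‖_q = tr (|A| ^ q) ^ (1 / q)`. -/
instance instNorm : Norm (SchattenClass H q) :=
  ⟨fun A => (schattenSum q (toOp H q A)).toReal ^ (1 / q)⟩

theorem norm_def (A : SchattenClass H q) :
    ‖A‖ = (schattenSum q (toOp H q A)).toReal ^ (1 / q) := rfl

theorem ofReal_norm_eq (A : SchattenClass H q) :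
    ENNReal.ofReal ‖A‖ = schattenSum q (toOp H q A) ^ (1 / q) := by
  have hq0 : 0 < q := by linarith [hq.out]
  rw [norm_def, ← ENNReal.ofReal_rpow_of_nonneg ENNReal.toReal_nonneg (by positivity),
    ENNReal.ofReal_toReal A.schattenSum_ne_top]

theorem norm_nonneg' (A : SchattenClass H q) : 0 ≤ ‖A‖ := by
  rw [norm_def]; positivity

theorem norm_toOp_le (A : SchattenClass H q) : ‖toOp H q A‖ ≤ ‖A‖ := by
  rw [← ENNReal.ofReal_le_ofReal_iff A.norm_nonneg', ofReal_norm_eq, ofReal_norm]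
  exact enorm_le_schattenSum_rpow hq.out A.isCompactOperator

theorem normedSpaceCore : NormedSpace.Core ℂ (SchattenClass H q) :=
  { norm_nonneg := norm_nonneg'
    norm_smul := by
      have hle : ∀ (c : ℂ) (A : SchattenClass H q), ‖c • A‖ ≤ ‖c‖ * ‖A‖ := by
        intro c A
        have hq0 : 0 < q := by linarith [hq.out]
        rw [← ENNReal.ofReal_le_ofReal_iff (mul_nonneg (norm_nonneg c) A.norm_nonneg'),
          ENNReal.ofReal_mul (norm_nonneg c), ofReal_norm_eq, ofReal_norm_eq, map_smul,
          ofReal_norm, one_div, ENNReal.rpow_inv_le_iff hq0,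
          ENNReal.mul_rpow_of_nonneg _ _ hq0.le, ENNReal.rpow_inv_rpow hq0.ne']
        exact schattenSum_smul_le hq.out A.isCompactOperator c
      intro c A
      refine le_antisymm (hle c A) ?_
      rcases eq_or_ne c 0 with rfl | hc
      · simpa using norm_nonneg' _
      · have h := hle c⁻¹ (c • A)
        rw [smul_smul, inv_mul_cancel₀ hc, one_smul, norm_inv] at h
        have hc' : 0 < ‖c‖ := norm_pos_iff.2 hc
        calc ‖c‖ * ‖A‖ ≤ ‖c‖ * (‖c‖⁻¹ * ‖c • A‖) := by gcongr
          _ = ‖c • A‖ := by field_simp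
    norm_triangle := by
      intro A B
      rw [← ENNReal.ofReal_le_ofReal_iff (add_nonneg A.norm_nonneg' B.norm_nonneg'),
        ENNReal.ofReal_add A.norm_nonneg' B.norm_nonneg', ofReal_norm_eq, ofReal_norm_eq,
        ofReal_norm_eq, map_add]
      exact schattenSum_add_rpow_le hq.out A.isCompactOperator B.isCompactOperator
    norm_eq_zero_iff := by
      intro A
      constructor
      · intro h
        have h1 := A.norm_toOp_le
        rw [h, norm_le_zero_iff] at h1
        exact toOp_injective (by rw [h1, map_zero])
      · rintro rfl
        have hq0 : q ≠ 0 := by linarith [hq.out]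
        rw [norm_def, map_zero, schattenSum_zero hq.out]
        simp [hq0] }

instance instNormedAddCommGroup : NormedAddCommGroup (SchattenClass H q) :=
  NormedAddCommGroup.ofCore normedSpaceCore

instance instNormedSpace : NormedSpace ℂ (SchattenClass H q) := NormedSpace.ofCore normedSpaceCore

/-- `S_q` is a Banach space. -/
instance instCompleteSpace : CompleteSpace (SchattenClass H q) := by
  have hq1 : 1 ≤ q := hq.out
  have hq0 : 0 < q := by linarith
  refine Metric.complete_of_cauchySeq_tendsto fun a ha => ?_
  have hcont : UniformContinuous (toOp H q) :=
    ((toOp H q).mkContinuous 1 fun A => by simpa using A.norm_toOp_le).uniformContinuous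
  obtain ⟨T, hT⟩ := cauchySeq_tendsto_of_complete (hcont.comp_cauchySeq ha)
  have hTc : IsCompactOperator T :=
    isCompactOperator_of_tendsto hT (Filter.Eventually.of_forall fun n => (a n).isCompactOperator)
  have key : ∀ ε > 0, ∃ N, ∀ n ≥ N,
      schattenSum q (T - toOp H q (a n)) ≤ ENNReal.ofReal ε ^ q := by
    intro ε hε
    obtain ⟨N, hN⟩ := Metric.cauchySeq_iff.1 ha ε hε
    refine ⟨N, fun n hn => ?_⟩
    refine schattenSum_le_of_forall hq1 (hTc.sub (a n).isCompactOperator) fun m e f he hf => ?_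
    have hlim : Filter.Tendsto
        (fun j => ∑ k, ‖⟪f k, (toOp H q (a j) - toOp H q (a n)) (e k)⟫_ℂ‖ₑ ^ q) Filter.atTop
        (nhds (∑ k, ‖⟪f k, (T - toOp H q (a n)) (e k)⟫_ℂ‖ₑ ^ q)) := by
      refine tendsto_finsetSum _ fun k _ => ?_
      refine (ENNReal.continuous_rpow_const.tendsto _).comp ?_
      refine (continuous_enorm.tendsto _).comp ?_
      have hc : Continuous fun S : H →L[ℂ] H => ⟪f k, (S - toOp H q (a n)) (e k)⟫_ℂ := by
        fun_prop
      exact (hc.tendsto T).comp hT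
    refine le_of_tendsto hlim (Filter.eventually_atTop.2 ⟨N, fun j hj => ?_⟩)
    rw [← map_sub]
    refine (sum_inner_rpow_le_schattenSum hq1 (a j - a n).isCompactOperator he hf).trans ?_
    have h1 : ‖a j - a n‖ ≤ ε := by rw [← dist_eq_norm]; exact (hN j hj n hn).le
    rw [← ENNReal.rpow_inv_le_iff hq0, ← one_div, ← ofReal_norm_eq]
    exact ENNReal.ofReal_le_ofReal h1
  have hmem : T ∈ schattenSubmodule H q := by
    obtain ⟨N, hN⟩ := key 1 one_pos
    have h1 : T - toOp H q (a N) ∈ schattenSubmodule H q :=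
      ⟨hTc.sub (a N).isCompactOperator, (hN N le_rfl).trans_lt (by simp)⟩
    have h2 := (schattenSubmodule H q).add_mem h1 (a N).2
    have h3 : T - toOp H q (a N) + (a N).1 = T := sub_add_cancel T _
    rwa [h3] at h2
  let L : SchattenClass H q := ⟨T, hmem⟩
  refine ⟨L, Metric.tendsto_atTop.2 fun ε hε => ?_⟩
  obtain ⟨N, hN⟩ := key (ε / 2) (half_pos hε)
  refine ⟨N, fun n hn => lt_of_le_of_lt ?_ (half_lt_self hε)⟩
  rw [dist_comm, dist_eq_norm, ← ENNReal.ofReal_le_ofReal_iff (half_pos hε).le, ofReal_norm_eq,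
    one_div, ENNReal.rpow_inv_le_iff hq0, map_sub]
  exact hN n hn

end SchattenClass

section Padic

variable (p : ℕ) [hp : Fact p.Prime]

instance padicMeasurableSpace : MeasurableSpace ℚ_[p] := borel _

instance padicBorelSpace : BorelSpace ℚ_[p] := ⟨rfl⟩

/-- The compact open subgroup `ℤ_p ^ n` of `ℚ_p ^ n`. -/
def padicPolydisc (n : ℕ) : TopologicalSpace.PositiveCompacts (Fin n → ℚ_[p]) where
  carrier := {x | ∀ i, ‖x i‖ ≤ 1}
  isCompact' := by
    have h : {x : Fin n → ℚ_[p] | ∀ i, ‖x i‖ ≤ 1} = Metric.closedBall 0 1 := by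
      ext x; simp [pi_norm_le_iff_of_nonneg]
    rw [h]
    exact isCompact_closedBall 0 1
  interior_nonempty' := by
    refine ⟨0, mem_interior.2 ⟨Metric.ball 0 1, fun x hx i => ?_, Metric.isOpen_ball, by simp⟩⟩
    have h : ‖x‖ < 1 := by simpa using hx
    exact (norm_le_pi_norm x i).trans h.le

/-- The Haar measure on `ℚ_p ^ n`, normalized by giving `ℤ_p ^ n` measure `1`. -/
def padicHaar (n : ℕ) : Measure (Fin n → ℚ_[p]) :=
  Measure.addHaarMeasure (padicPolydisc p n)

variable {p}

/-- The number of digits of `x` at negative powers of `p`: it is `-γ` if `x = ∑_{i ≥ γ} x_i p ^ i`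
with `x_γ ≠ 0` and `γ < 0`, and `0` if `x ∈ ℤ_p`. -/
def padicPoleOrder (x : ℚ_[p]) : ℕ := (-x.valuation).toNat

theorem norm_mul_pow_padicPoleOrder_le (x : ℚ_[p]) : ‖x * (p : ℚ_[p]) ^ padicPoleOrder x‖ ≤ 1 := by
  rcases eq_or_ne x 0 with rfl | hx
  · simp
  have hp1 : (1 : ℝ) < p := by exact_mod_cast hp.out.one_lt
  have hp0 : (p : ℝ) ≠ 0 := by positivity
  rw [norm_mul, Padic.norm_eq_zpow_neg_valuation hx, Padic.norm_p_pow, ← zpow_add₀ hp0]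
  refine zpow_le_one_of_nonpos₀ hp1.le ?_
  rw [padicPoleOrder]
  have := Int.self_le_toNat (-x.valuation)
  linarith

/-- The fractional part `{x}_p = ∑_{γ ≤ i < 0} x_i p ^ i` of `x = ∑_{i ≥ γ} x_i p ^ i`, with digits
`0 ≤ x_i < p`. With `k = padicPoleOrder x`, the number `x p ^ k` is a `p`-adic integer, the sum of
its first `k` terms is `PadicInt.appr (x p ^ k) k`, and dividing this by `p ^ k` gives `{x}_p`. -/
def padicFract (x : ℚ_[p]) : ℝ :=
  (PadicInt.appr ⟨x * (p : ℚ_[p]) ^ padicPoleOrder x, norm_mul_pow_padicPoleOrder_le x⟩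
    (padicPoleOrder x) : ℝ) / (p : ℝ) ^ padicPoleOrder x

/-- The conjugate of the character `θ ↦ exp (2 π i {ξ_1 θ_1 + ... + ξ_n θ_n}_p)` of `ℚ_p ^ n`. -/
def padicKernel {n : ℕ} (ξ θ : Fin n → ℚ_[p]) : ℂ :=
  Complex.exp (-(2 * Real.pi * Complex.I * (padicFract (∑ i, ξ i * θ i) : ℂ)))

/-- The operator-valued Fourier transform
`B_ξ = ∫ exp (-2 π i {ξ_1 θ_1 + ... + ξ_n θ_n}_p) A_θ dθ`, a Bochner integral in `S_q`. -/
def padicFourier {q : ℝ} [Fact (1 ≤ q)] {n : ℕ} (A : (Fin n → ℚ_[p]) → SchattenClass H q)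
    (ξ : Fin n → ℚ_[p]) : SchattenClass H q :=
  ∫ θ, padicKernel ξ θ • A θ ∂(padicHaar p n)

end Padic

end

-- For `1 < q` the inequality is a Hausdorff-Young estimate, obtained by interpolating between
-- `L¹(S_1) → L^∞`, which only uses that the kernel has modulus at most one, and the Plancherel
-- identity in `L²(S_2)`. Harmonic analysis on `ℚ_p ^ n` enters only through finite character sums.
--
-- Reduction to finite sums: let `D` be the lattice of vectors of norm at most `p ^ k` and `L` the
-- one of norm at most `p ^ (-k)`. For `ξ, θ ∈ D` the kernel depends only on the classes of `ξ` and
-- `θ` modulo `L`, because `D` and `L` annihilate each other. So the transform of `A` cut off to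
-- `D`, restricted to `D`, is a finite transform of the integrals of `A` over the cosets of `L`, and
-- its matrix has orthogonal columns (`sum_star_padicKernel_mul`). Hölder on each coset and the
-- self-duality `μ(D) μ(L) = 1` turn the finite inequality into one with constant exactly `1`
-- (`setLIntegral_enorm_rpow_le`). Fatou's lemma lets `k → ∞`.
--
-- The finite inequality (`sum_singular_rpow_le`) is proved by duality. The transforms are paired
-- with the extremal dual family built from their own singular vectors, and the operators are
-- replaced by finite parts of their singular value decompositions. Raising singular values and dual
-- coefficients to complex powers gives a finite sum of exponentials in `z`, bounded by the two
-- endpoint estimates on `Re z = 0` and `Re z = 1`; the three lines theorem at `2 / r` gives the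
-- claim. Since only rank one operators occur, the Hilbert-Schmidt structure is modelled by a tensor
-- product.
--
-- For `q = 1` the triangle inequality for the Bochner integral suffices.

universe u

/-! ### Hilbert-Schmidt geometry of rank one operators and the two endpoint estimates -/

section HilbertSchmidt

variable {H : Type*} [NormedAddCommGroup H] [InnerProductSpace ℂ H]

/-- Every complex Hilbert space admits a map into another one that conjugates inner products. -/
theorem exists_inner_conj_map [CompleteSpace H] :
    ∃ (w : Set H) (J : H → lp (fun _ : w => ℂ) 2), ∀ x y, ⟪J x, J y⟫_ℂ = ⟪y, x⟫_ℂ := by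
  obtain ⟨w, b, -⟩ := exists_hilbertBasis ℂ H
  -- `J` conjugates the coordinates in a Hilbert basis.
  refine ⟨w, fun x => star (b.repr x), fun x y => ?_⟩
  rw [← b.repr.inner_map_map y x, lp.inner_eq_tsum, lp.inner_eq_tsum]
  refine tsum_congr fun i => ?_
  simp [mul_comm]

/-- An inner product space containing the rank one operators `⟪u, ·⟫ v`, written `T v u`, with the
Hilbert-Schmidt inner product. -/
theorem exists_hilbertSchmidt_space {H : Type u} [NormedAddCommGroup H] [InnerProductSpace ℂ H]
    [CompleteSpace H] :
    ∃ (E : Type u) (_ : NormedAddCommGroup E) (_ : InnerProductSpace ℂ E) (T : H → H → E),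
      ∀ f e v u, ⟪T f e, T v u⟫_ℂ = ⟪f, v⟫_ℂ * ⟪u, e⟫_ℂ := by
  obtain ⟨w, J, hJ⟩ := exists_inner_conj_map (H := H)
  -- The operator `⟪u, ·⟫ v` is conjugate linear in `u`, hence the tensor with `J u`. The algebraic
  -- tensor product is enough: only finite combinations occur, so completeness is not needed.
  refine ⟨TensorProduct ℂ H (lp (fun _ : w => ℂ) 2), inferInstance, inferInstance,
    fun v u => TensorProduct.tmul ℂ v (J u), fun f e v u => ?_⟩
  rw [TensorProduct.inner_tmul, hJ]

/-- Consequently a finite part of a singular value decomposition has as Hilbert-Schmidt norm the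
`ℓ²` norm of its coefficients. -/
theorem orthonormal_of_inner_rankOne {E σ : Type*} [NormedAddCommGroup E] [InnerProductSpace ℂ E]
    {T : H → H → E} (hT : ∀ f e v u, ⟪T f e, T v u⟫_ℂ = ⟪f, v⟫_ℂ * ⟪u, e⟫_ℂ) {a b : σ → H}
    (ha : Orthonormal ℂ a) (hb : Orthonormal ℂ b) : Orthonormal ℂ (fun i => T (a i) (b i)) := by
  classical
  rw [orthonormal_iff_ite] at ha hb ⊢
  intro i j
  rw [hT, ha, hb]
  by_cases h : i = j <;> simp [h, eq_comm]

/-- Plancherel's identity, for vectors in an inner product space and a matrix with orthogonal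
columns. -/
theorem sum_norm_sq_sum_smul {E R Q : Type*} [NormedAddCommGroup E] [InnerProductSpace ℂ E]
    [Fintype R] [Fintype Q] [DecidableEq Q] {K : R → Q → ℂ} {N : ℝ}
    (hK : ∀ c d, ∑ ξ, star (K ξ c) * K ξ d = if c = d then (N : ℂ) else 0) (a : Q → E) :
    ∑ ξ, ‖∑ c, K ξ c • a c‖ ^ 2 = N * ∑ c, ‖a c‖ ^ 2 := by
  have h : ((∑ ξ, ‖∑ c, K ξ c • a c‖ ^ 2 : ℝ) : ℂ) = ((N * ∑ c, ‖a c‖ ^ 2 : ℝ) : ℂ) := by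
    push_cast
    have h1 : ∀ x : E, ((‖x‖ : ℂ)) ^ 2 = ⟪x, x⟫_ℂ := fun x =>
      (inner_self_eq_norm_sq_to_K x).symm
    simp_rw [h1, sum_inner, inner_sum, inner_smul_left, inner_smul_right]
    rw [Finset.sum_comm, Finset.mul_sum]
    refine Finset.sum_congr rfl fun c _ => ?_
    rw [Finset.sum_comm]
    calc ∑ d, ∑ ξ, (starRingEnd ℂ) (K ξ c) * (K ξ d * ⟪a c, a d⟫_ℂ)
        = ∑ d, (∑ ξ, star (K ξ c) * K ξ d) * ⟪a c, a d⟫_ℂ := by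
          refine Finset.sum_congr rfl fun d _ => ?_
          rw [Finset.sum_mul]
          exact Finset.sum_congr rfl fun ξ _ => by rw [mul_assoc]; rfl
      _ = N * ⟪a c, a c⟫_ℂ := by simp only [hK]; simp
  exact_mod_cast h

theorem norm_sq_sum_smul_orthonormal {E ι : Type*} [NormedAddCommGroup E] [InnerProductSpace ℂ E]
    [Fintype ι] {v : ι → E} (hv : Orthonormal ℂ v) (x : ι → ℂ) :
    ‖∑ i, x i • v i‖ ^ 2 = ∑ i, ‖x i‖ ^ 2 := by
  have h := hv.inner_sum x x Finset.univ
  rw [inner_self_eq_norm_sq_to_K] at h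
  have h2 : ∑ i, (starRingEnd ℂ) (x i) * x i = ((∑ i, ‖x i‖ ^ 2 : ℝ) : ℂ) := by
    push_cast
    exact Finset.sum_congr rfl fun i _ => Complex.conj_mul' _
  rw [h2] at h
  exact Complex.ofReal_injective (by simpa using h)

variable {R Q : Type*} [Fintype R] [Fintype Q] {ι : Q → Type*} {κ : R → Type*}
  [∀ c, Fintype (ι c)] [∀ ξ, Fintype (κ ξ)]
  {u v : ∀ c, ι c → H} {e f : ∀ ξ, κ ξ → H}

/-- The endpoint estimate `L² → L²` for the pairing of the Fourier transform of a finite family of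
finite rank operators with another such family. -/
theorem norm_pairing_le_sqrt [CompleteSpace H] [DecidableEq Q] {K : R → Q → ℂ} {N : ℝ} (hN : 0 ≤ N)
    (hK : ∀ c d, ∑ ξ, star (K ξ c) * K ξ d = if c = d then (N : ℂ) else 0)
    (hu : ∀ c, Orthonormal ℂ (u c)) (hv : ∀ c, Orthonormal ℂ (v c))
    (he : ∀ ξ, Orthonormal ℂ (e ξ)) (hf : ∀ ξ, Orthonormal ℂ (f ξ))
    (x : ∀ c, ι c → ℂ) (y : ∀ ξ, κ ξ → ℂ) :
    ‖∑ ξ, ∑ j, ∑ c, ∑ i, K ξ c * (⟪u c i, e ξ j⟫_ℂ * ⟪f ξ j, v c i⟫_ℂ) * (x c i * y ξ j)‖ ≤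
      √N * √(∑ c, ∑ i, ‖x c i‖ ^ 2) * √(∑ ξ, ∑ j, ‖y ξ j‖ ^ 2) := by
  classical
  obtain ⟨E, _, _, T, hT⟩ := exists_hilbertSchmidt_space (H := H)
  -- The pairing becomes `∑ ξ, ⟪g ξ, (transform of a) ξ⟫`, so Cauchy-Schwarz and Plancherel apply.
  -- The conjugate in `g` offsets the conjugate linearity of the inner product in its first slot.
  let a := fun c => ∑ i, x c i • T (v c i) (u c i)
  let g := fun ξ => ∑ j, star (y ξ j) • T (f ξ j) (e ξ j)
  have ha : ∀ c, ‖a c‖ ^ 2 = ∑ i, ‖x c i‖ ^ 2 := fun c =>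
    norm_sq_sum_smul_orthonormal (orthonormal_of_inner_rankOne hT (hv c) (hu c)) _
  have hg : ∀ ξ, ‖g ξ‖ ^ 2 = ∑ j, ‖y ξ j‖ ^ 2 := fun ξ => by
    rw [norm_sq_sum_smul_orthonormal (orthonormal_of_inner_rankOne hT (hf ξ) (he ξ))]
    simp
  have hsum : ∑ ξ, ∑ j, ∑ c, ∑ i, K ξ c * (⟪u c i, e ξ j⟫_ℂ * ⟪f ξ j, v c i⟫_ℂ) *
      (x c i * y ξ j) = ∑ ξ, ⟪g ξ, ∑ c, K ξ c • a c⟫_ℂ := by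
    refine Finset.sum_congr rfl fun ξ _ => ?_
    rw [sum_inner]
    refine Finset.sum_congr rfl fun j _ => ?_
    rw [inner_sum]
    refine Finset.sum_congr rfl fun c _ => ?_
    rw [inner_smul_right, inner_sum, Finset.mul_sum]
    refine Finset.sum_congr rfl fun i _ => ?_
    rw [inner_smul_left, inner_smul_right, hT]
    simp
    ring
  rw [hsum]
  calc ‖∑ ξ, ⟪g ξ, ∑ c, K ξ c • a c⟫_ℂ‖ ≤ ∑ ξ, ‖∑ c, K ξ c • a c‖ * ‖g ξ‖ :=
        norm_sum_le_of_le _ fun ξ _ => (norm_inner_le_norm _ _).trans_eq (mul_comm _ _)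
    _ ≤ √(∑ ξ, ‖∑ c, K ξ c • a c‖ ^ 2) * √(∑ ξ, ‖g ξ‖ ^ 2) :=
        Real.sum_mul_le_sqrt_mul_sqrt _ _ _
    _ = _ := by
        rw [sum_norm_sq_sum_smul hK, Real.sqrt_mul hN]
        simp_rw [ha, hg]

/-- The endpoint estimate `L¹ → L^∞` for the pairing of the Fourier transform of a finite family of
finite rank operators with another such family. -/
theorem norm_pairing_le_sum {K : R → Q → ℂ} (hK : ∀ ξ c, ‖K ξ c‖ ≤ 1)
    (hu : ∀ c i, ‖u c i‖ = 1) (hv : ∀ c i, ‖v c i‖ = 1)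
    (he : ∀ ξ, Orthonormal ℂ (e ξ)) (hf : ∀ ξ, Orthonormal ℂ (f ξ))
    (x : ∀ c, ι c → ℂ) (y : ∀ ξ, κ ξ → ℂ) {w : R → ℝ} (hw : ∀ ξ, 0 ≤ w ξ)
    (hy : ∀ ξ j, ‖y ξ j‖ ≤ w ξ) :
    ‖∑ ξ, ∑ j, ∑ c, ∑ i, K ξ c * (⟪u c i, e ξ j⟫_ℂ * ⟪f ξ j, v c i⟫_ℂ) * (x c i * y ξ j)‖ ≤
      (∑ c, ∑ i, ‖x c i‖) * ∑ ξ, w ξ := by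
  rw [Finset.mul_sum]
  refine norm_sum_le_of_le _ fun ξ _ => ?_
  -- The sum over `j` is moved inside: for a fixed pair `u c i`, `v c i` of unit vectors, Bessel's
  -- inequality for `e ξ` and `f ξ` bounds the sum over `j` by one.
  rw [Finset.sum_comm, Finset.sum_mul]
  refine norm_sum_le_of_le _ fun c _ => ?_
  rw [Finset.sum_comm, Finset.sum_mul]
  refine norm_sum_le_of_le _ fun i _ => ?_
  calc ‖∑ j, K ξ c * (⟪u c i, e ξ j⟫_ℂ * ⟪f ξ j, v c i⟫_ℂ) * (x c i * y ξ j)‖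
      ≤ ∑ j, ‖⟪e ξ j, u c i⟫_ℂ‖ * ‖⟪f ξ j, v c i⟫_ℂ‖ * (‖x c i‖ * w ξ) := by
        refine norm_sum_le_of_le _ fun j _ => ?_
        simp only [norm_mul]
        rw [norm_inner_symm (u c i)]
        calc _ ≤ 1 * (‖⟪e ξ j, u c i⟫_ℂ‖ * ‖⟪f ξ j, v c i⟫_ℂ‖) * (‖x c i‖ * w ξ) := by
              gcongr
              · exact hK ξ c
              · exact hy ξ j
          _ = _ := by rw [one_mul]
    _ ≤ 1 * (‖x c i‖ * w ξ) := by
        rw [← Finset.sum_mul]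
        have := hw ξ
        gcongr
        exact bessel_mix (he ξ) (hf ξ) (hu c i) (hv c i) Finset.univ
    _ = ‖x c i‖ * w ξ := one_mul _

end HilbertSchmidt

/-! ### Complex interpolation -/

/-- The three lines theorem for a finite sum of exponentials. -/
theorem norm_sum_cpow_interpolation {P : Type*} [Fintype P] (M : P → ℂ) {a b : P → ℝ}
    (ha : ∀ k, 0 < a k) (hb : ∀ k, 0 < b k) {C₀ C₁ : ℝ}
    (h₀ : ∀ z : ℂ, z.re = 0 → ‖∑ k, M k * ((a k : ℂ) ^ (1 - z / 2) * (b k : ℂ) ^ (z / 2))‖ ≤ C₀)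
    (h₁ : ∀ z : ℂ, z.re = 1 → ‖∑ k, M k * ((a k : ℂ) ^ (1 - z / 2) * (b k : ℂ) ^ (z / 2))‖ ≤ C₁)
    {t : ℝ} (ht : t ∈ Set.Icc (0 : ℝ) 1) :
    ‖∑ k, M k * ((a k ^ (1 - t / 2) * b k ^ (t / 2) : ℝ) : ℂ)‖ ≤ C₀ ^ (1 - t) * C₁ ^ t := by
  let F : ℂ → ℂ := fun z => ∑ k, M k * ((a k : ℂ) ^ (1 - z / 2) * (b k : ℂ) ^ (z / 2))
  have ha0 : ∀ k, (a k : ℂ) ≠ 0 := fun k => by exact_mod_cast (ha k).ne'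
  have hb0 : ∀ k, (b k : ℂ) ≠ 0 := fun k => by exact_mod_cast (hb k).ne'
  have hF : Differentiable ℂ F := by
    refine Differentiable.fun_sum fun k _ => (Differentiable.mul ?_ ?_).const_mul _
    · exact Differentiable.const_cpow (by fun_prop) (Or.inl (ha0 k))
    · exact Differentiable.const_cpow (by fun_prop) (Or.inl (hb0 k))
  -- The modulus of each exponential depends only on `Re z`, so compactness of `[0, 1]` bounds the
  -- sum on the whole strip.
  have hbd : BddAbove ((norm ∘ F) '' Complex.HadamardThreeLines.verticalClosedStrip 0 1) := by
    have hc : Continuous fun s : ℝ => ∑ k, ‖M k‖ * (a k ^ (1 - s / 2) * b k ^ (s / 2)) := by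
      refine continuous_finsetSum _ fun k _ => continuous_const.mul (Continuous.mul ?_ ?_)
      · exact Continuous.rpow continuous_const (by fun_prop) fun _ => Or.inl (ha k).ne'
      · exact Continuous.rpow continuous_const (by fun_prop) fun _ => Or.inl (hb k).ne'
    obtain ⟨C, hC⟩ := (isCompact_Icc (a := (0 : ℝ)) (b := 1)).bddAbove_image hc.continuousOn
    refine ⟨C, ?_⟩
    rintro _ ⟨z, hz, rfl⟩
    refine le_trans ?_ (hC ⟨z.re, hz, rfl⟩)
    refine norm_sum_le_of_le _ fun k _ => ?_
    rw [norm_mul, norm_mul, Complex.norm_cpow_eq_rpow_re_of_pos (ha k),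
      Complex.norm_cpow_eq_rpow_re_of_pos (hb k)]
    simp
  have h := Complex.HadamardThreeLines.norm_le_interp_of_mem_verticalClosedStrip₀₁' F
    (z := (t : ℂ)) (by simpa [Complex.HadamardThreeLines.verticalClosedStrip] using ht)
    hF.diffContOnCl hbd (fun z hz => h₀ z hz) (fun z hz => h₁ z hz)
  rw [Complex.ofReal_re] at h
  refine le_of_eq_of_le ?_ h
  congr 1
  refine Finset.sum_congr rfl fun k _ => ?_
  rw [Complex.ofReal_mul, Complex.ofReal_cpow (ha k).le, Complex.ofReal_cpow (hb k).le]
  push_cast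
  rfl

/-! ### Hausdorff-Young for finite matrices with orthogonal columns -/

section FiniteHausdorffYoung

variable {H : Type*} [NormedAddCommGroup H] [InnerProductSpace ℂ H] [CompleteSpace H]

/-- Interpolation between the two endpoint estimates for the pairing of the Fourier transform of a
finite family of finite rank operators with another such family. -/
theorem norm_pairing_interpolation {R Q : Type*} [Fintype R] [Fintype Q] [DecidableEq Q]
    {ι : Q → Type*} {κ : R → Type*} [∀ c, Fintype (ι c)] [∀ ξ, Fintype (κ ξ)]
    {u v : ∀ c, ι c → H} {e f : ∀ ξ, κ ξ → H} {K : R → Q → ℂ} {N : ℝ} (hN : 0 ≤ N)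
    (hK1 : ∀ ξ c, ‖K ξ c‖ ≤ 1)
    (hK : ∀ c d, ∑ ξ, star (K ξ c) * K ξ d = if c = d then (N : ℂ) else 0)
    (hu : ∀ c, Orthonormal ℂ (u c)) (hv : ∀ c, Orthonormal ℂ (v c))
    (he : ∀ ξ, Orthonormal ℂ (e ξ)) (hf : ∀ ξ, Orthonormal ℂ (f ξ))
    {α : ∀ c, ι c → ℝ} (hα : ∀ c i, 0 < α c i) {w : R → ℝ} (hw : ∀ ξ, 0 ≤ w ξ)
    {τ : ∀ ξ, κ ξ → ℝ} (hwτ : ∀ ξ j, 0 < w ξ ∧ 0 < τ ξ j) (hτ : ∀ ξ, ∑ j, τ ξ j ≤ 1)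
    {t : ℝ} (ht : t ∈ Set.Icc (0 : ℝ) 1) :
    ‖∑ ξ, ∑ j, ∑ c, ∑ i, K ξ c * (⟪u c i, e ξ j⟫_ℂ * ⟪f ξ j, v c i⟫_ℂ) *
        (((α c i ^ (1 - t / 2) : ℝ) : ℂ) * ((w ξ ^ (1 - t / 2) * τ ξ j ^ (t / 2) : ℝ) : ℂ))‖ ≤
      ((∑ c, ∑ i, α c i) * ∑ ξ, w ξ) ^ (1 - t) *
        (√N * √(∑ c, ∑ i, α c i) * √(∑ ξ, w ξ)) ^ t := by
  -- All indices are merged into one. The factor `α * w` carries the exponent `1 - z / 2` and `τ`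
  -- the exponent `z / 2`.
  let P := (Σ ξ, κ ξ) × (Σ c, ι c)
  let M : P → ℂ := fun k => K k.1.1 k.2.1 *
    (⟪u k.2.1 k.2.2, e k.1.1 k.1.2⟫_ℂ * ⟪f k.1.1 k.1.2, v k.2.1 k.2.2⟫_ℂ)
  let a : P → ℝ := fun k => α k.2.1 k.2.2 * w k.1.1
  let b : P → ℝ := fun k => τ k.1.1 k.1.2
  have hw' : ∀ k : Σ ξ, κ ξ, 0 < w k.1 := fun k => (hwτ k.1 k.2).1
  have ha : ∀ k, 0 < a k := fun k => mul_pos (hα _ _) (hw' _)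
  have hb : ∀ k, 0 < b k := fun k => (hwτ _ _).2
  have hsum : ∀ z : ℂ, ∑ k, M k * ((a k : ℂ) ^ (1 - z / 2) * (b k : ℂ) ^ (z / 2)) =
      ∑ ξ, ∑ j, ∑ c, ∑ i, K ξ c * (⟪u c i, e ξ j⟫_ℂ * ⟪f ξ j, v c i⟫_ℂ) *
        ((α c i : ℂ) ^ (1 - z / 2) * ((w ξ : ℂ) ^ (1 - z / 2) * (τ ξ j : ℂ) ^ (z / 2))) := by
    intro z
    rw [Fintype.sum_prod_type, Fintype.sum_sigma]
    refine Finset.sum_congr rfl fun ξ _ => Finset.sum_congr rfl fun j _ => ?_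
    rw [Fintype.sum_sigma]
    refine Finset.sum_congr rfl fun c _ => Finset.sum_congr rfl fun i _ => ?_
    simp only [M, a, b]
    rw [Complex.ofReal_mul, Complex.mul_cpow_ofReal_nonneg (hα c i).le (hw ξ)]
    ring
  have key := norm_sum_cpow_interpolation M ha hb (C₀ := (∑ c, ∑ i, α c i) * ∑ ξ, w ξ)
    (C₁ := √N * √(∑ c, ∑ i, α c i) * √(∑ ξ, w ξ)) ?_ ?_ ht
  · refine le_of_eq_of_le ?_ key
    congr 1
    rw [Fintype.sum_prod_type, Fintype.sum_sigma]
    refine Finset.sum_congr rfl fun ξ _ => Finset.sum_congr rfl fun j _ => ?_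
    rw [Fintype.sum_sigma]
    refine Finset.sum_congr rfl fun c _ => Finset.sum_congr rfl fun i _ => ?_
    simp only [M, a, b]
    rw [Real.mul_rpow (hα c i).le (hw ξ)]
    push_cast
    ring
  -- On `Re z = 0` the coefficients have moduli `α` and `w`, as `τ` enters with exponent of real
  -- part zero.
  · intro z hz
    rw [hsum]
    refine (norm_pairing_le_sum hK1 (fun c => (hu c).1) (fun c => (hv c).1) he hf _ _ hw
      fun ξ j => ?_).trans (le_of_eq ?_)
    · rw [norm_mul, Complex.norm_cpow_eq_rpow_re_of_pos (hwτ ξ j).1,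
        Complex.norm_cpow_eq_rpow_re_of_pos (hwτ ξ j).2]
      simp [hz]
    · congr 1
      refine Finset.sum_congr rfl fun c _ => Finset.sum_congr rfl fun i _ => ?_
      rw [Complex.norm_cpow_eq_rpow_re_of_pos (hα c i)]
      simp [hz]
  -- On `Re z = 1` the squared moduli are `α` and `w * τ`, and the latter sum over `j` to at most
  -- `w`.
  · intro z hz
    have hsq : ∀ x : ℝ, 0 ≤ x → (x ^ (1 / 2 : ℝ)) ^ 2 = x := fun x hx => by
      rw [← Real.sqrt_eq_rpow, Real.sq_sqrt hx]
    have e1 : (1 - z / 2).re = 1 / 2 := by simp [hz]; norm_num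
    have e2 : (z / 2).re = 1 / 2 := by simp [hz]
    rw [hsum]
    refine (norm_pairing_le_sqrt hN hK hu hv he hf _ _).trans ?_
    gcongr with c _ i _ ξ _
    · rw [Complex.norm_cpow_eq_rpow_re_of_pos (hα c i), e1, hsq _ (hα c i).le]
    · calc _ = ∑ j, w ξ * τ ξ j := by
            refine Finset.sum_congr rfl fun j _ => ?_
            rw [norm_mul, Complex.norm_cpow_eq_rpow_re_of_pos (hwτ ξ j).1,
              Complex.norm_cpow_eq_rpow_re_of_pos (hwτ ξ j).2, e1, e2, mul_pow,
              hsq _ (hwτ ξ j).1.le, hsq _ (hwτ ξ j).2.le]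
        _ ≤ w ξ := by
            rw [← Finset.mul_sum]
            exact mul_le_of_le_one_right (hw ξ) (hτ ξ)

/-- Truncations are indexed by families of finite sets, one for each operator. This makes all the
singular value series converge along one common filter. -/
theorem tendsto_eval_finset_atTop {R : Type*} {κ : R → Type*} (ξ : R) :
    Filter.Tendsto (fun I : ∀ ξ, Finset (κ ξ) => I ξ) Filter.atTop Filter.atTop := by
  classical
  refine Filter.tendsto_atTop.2 fun s => Filter.eventually_atTop.2
    ⟨Function.update (fun _ => ∅) ξ s, fun I hI => ?_⟩
  simpa using hI ξ

/-- The Hausdorff-Young inequality for a unitary matrix up to scaling, tested against finite parts of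
the singular value decompositions of the transforms. -/
theorem sum_singular_rpow_le {q r : ℝ} (hqr : q.HolderConjugate r) (hq2 : q ≤ 2)
    {R Q : Type*} [Fintype R] [Fintype Q] [DecidableEq Q] {K : R → Q → ℂ} {N : ℝ} (hN : 0 ≤ N)
    (hK1 : ∀ ξ c, ‖K ξ c‖ ≤ 1)
    (hK : ∀ c d, ∑ ξ, star (K ξ c) * K ξ d = if c = d then (N : ℂ) else 0)
    {a : Q → H →L[ℂ] H} (ha : ∀ c, IsCompactOperator (a c))
    (hfin : ∑ c, schattenSum q (a c) ≠ ∞)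
    {κ : R → Type*} [∀ ξ, Fintype (κ ξ)] {e f : ∀ ξ, κ ξ → H} {t : ∀ ξ, κ ξ → ℝ}
    (he : ∀ ξ, Orthonormal ℂ (e ξ)) (hf : ∀ ξ, Orthonormal ℂ (f ξ)) (ht : ∀ ξ j, 0 < t ξ j)
    (hat : ∀ ξ j, ⟪f ξ j, (∑ c, K ξ c • a c) (e ξ j)⟫_ℂ = t ξ j) :
    ∑ ξ, (∑ j, t ξ j ^ q) ^ (r / q) ≤ N * (∑ c, schattenSum q (a c)).toReal ^ (r / q) := by
  classical
  have hq0 : 0 < q := hqr.pos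
  have hr0 : 0 < r := hqr.symm.pos
  have hqr' : q⁻¹ + r⁻¹ = 1 := by simpa using hqr.inv_add_inv_eq_one
  have hmul : q + r = q * r := by field_simp at hqr'; linarith
  choose ι u v s hu hv hs hau hker hsum using fun c => exists_singular_system (ha c) q
  set X := (∑ c, schattenSum q (a c)).toReal with hX
  let S : R → ℝ := fun ξ => ∑ j, t ξ j ^ q
  let w : R → ℝ := fun ξ => S ξ ^ (r / q)
  have hS0 : ∀ ξ, 0 ≤ S ξ := fun ξ => Finset.sum_nonneg fun j _ => by have := ht ξ j; positivity
  -- If `κ ξ` is empty then `S ξ` and `w ξ` vanish, so positivity is only available, and only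
  -- needed, in the presence of an index `j`.
  have hSpos : ∀ ξ, κ ξ → 0 < S ξ := fun ξ j =>
    Finset.sum_pos (fun j _ => by have := ht ξ j; positivity) ⟨j, Finset.mem_univ j⟩
  have hw0 : ∀ ξ, 0 ≤ w ξ := fun ξ => by have := hS0 ξ; positivity
  set W := ∑ ξ, w ξ with hW
  have hW0 : 0 ≤ W := Finset.sum_nonneg fun ξ _ => hw0 ξ
  let τ : ∀ ξ, κ ξ → ℝ := fun ξ j => t ξ j ^ q / S ξ
  have hτ : ∀ ξ, ∑ j, τ ξ j ≤ 1 := fun ξ => by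
    rw [← Finset.sum_div]; exact div_self_le_one _
  -- The extremal dual coefficients: `w ξ` plays the role of the `r`-th power of the Schatten norm
  -- of the transform at `ξ`, and `τ ξ` is a normalized distribution of the `q`-th powers of its
  -- singular values. Equality in duality is `y * t = w * τ`, which sums to `W`.
  let y : ∀ ξ, κ ξ → ℝ := fun ξ j => w ξ ^ q⁻¹ * τ ξ j ^ r⁻¹
  have hyt : ∀ ξ j, y ξ j * t ξ j = w ξ * τ ξ j := by
    intro ξ j
    have h1 := hSpos ξ j
    have h2 := ht ξ j
    simp only [y, w, τ]
    rw [Real.div_rpow (by positivity) h1.le, ← Real.rpow_mul h1.le, ← Real.rpow_mul h2.le]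
    rw [mul_div_assoc', mul_div_assoc', div_mul_eq_mul_div, mul_assoc,
      div_eq_div_iff (by positivity) (by positivity)]
    nth_rewrite 2 [← Real.rpow_one (t ξ j)]
    rw [← Real.rpow_add h2]
    nth_rewrite 2 [← Real.rpow_one (S ξ)]
    have e1 : q * r⁻¹ + 1 = q := by field_simp; linarith
    have e2 : r / q * q⁻¹ + 1 = r / q + r⁻¹ := by
      have : r / q = r - 1 := by field_simp; linarith
      rw [this]
      have : r * q⁻¹ = r - 1 := by field_simp; linarith
      linear_combination this - hqr'
    rw [e1, mul_right_comm, ← Real.rpow_add h1, e2, Real.rpow_add h1]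
    ring
  -- the pairing of the transform of the truncated operators with the dual family
  let F : (∀ c, Finset (ι c)) → ℂ := fun I => ∑ ξ, ∑ j, ∑ c, ∑ i : I c,
    K ξ c * (⟪u c i, e ξ j⟫_ℂ * ⟪f ξ j, v c i⟫_ℂ) * ((s c i : ℂ) * (y ξ j : ℂ))
  have hFbound : ∀ I, ‖F I‖ ≤ N ^ r⁻¹ * X ^ q⁻¹ * W ^ q⁻¹ := by
    intro I
    -- The interpolation parameter `2 / r` gives `1 - t / 2 = 1 / q`, so that `α = s ^ q` returns
    -- the singular values `s` and `w`, `τ` return `y`. It lies in `[0, 1]` because `q ≤ 2`.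
    have hθ : 2 * r⁻¹ ∈ Set.Icc (0 : ℝ) 1 := by
      refine ⟨by positivity, ?_⟩
      have : (2 : ℝ)⁻¹ ≤ q⁻¹ := inv_anti₀ hq0 hq2
      linarith
    have h := norm_pairing_interpolation (u := fun c (i : I c) => u c i)
      (v := fun c (i : I c) => v c i) hN hK1 hK
      (fun c => (hu c).comp _ Subtype.val_injective)
      (fun c => (hv c).comp _ Subtype.val_injective) he hf
      (α := fun c i => s c i ^ q) (fun c i => by have := hs c i; positivity) hw0
      (τ := τ) (fun ξ j => ⟨by have := hSpos ξ j; positivity,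
        by have := hSpos ξ j; have := ht ξ j; positivity⟩) hτ hθ
    have e1 : (1 : ℝ) - r⁻¹ = q⁻¹ := by linarith
    have e2 : (2 : ℝ) * r⁻¹ / 2 = r⁻¹ := by linarith
    have e3 : ∀ c (i : I c), (s c i ^ q) ^ q⁻¹ = s c i := fun c i =>
      Real.rpow_rpow_inv (hs c i).le hq0.ne'
    simp only [e2, e1, e3] at h
    refine h.trans ?_
    have hX' : ∑ c, ∑ i : I c, s c i ^ q ≤ X := by
      rw [hX, ← ENNReal.ofReal_le_iff_le_toReal hfin,
        ENNReal.ofReal_sum_of_nonneg fun c _ => Finset.sum_nonneg fun i _ => by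
          have := hs c i; positivity]
      refine Finset.sum_le_sum fun c _ => ?_
      rw [hsum c, ENNReal.ofReal_sum_of_nonneg fun i _ => by have := hs c i; positivity,
        Finset.sum_coe_sort (I c) fun i => ENNReal.ofReal (s c i ^ q)]
      exact ENNReal.sum_le_tsum _
    have hx0 : 0 ≤ ∑ c, ∑ i : I c, s c i ^ q :=
      Finset.sum_nonneg fun c _ => Finset.sum_nonneg fun i _ => by have := hs c i; positivity
    have hX0 : 0 ≤ X := hx0.trans hX'
    have hθ1 := hθ.2
    calc _ ≤ (X * W) ^ (1 - 2 * r⁻¹) * (√N * √X * √W) ^ (2 * r⁻¹) := by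
          have : 0 ≤ 1 - 2 * r⁻¹ := by linarith
          gcongr
      _ = N ^ r⁻¹ * X ^ q⁻¹ * W ^ q⁻¹ := by
          have e4 : ∀ x : ℝ, 0 ≤ x → √x ^ (2 * r⁻¹) = x ^ r⁻¹ := fun x hx => by
            rw [Real.rpow_mul (Real.sqrt_nonneg x), Real.rpow_two, Real.sq_sqrt hx]
          have e5 : ∀ x : ℝ, 0 ≤ x → x ^ (1 - 2 * r⁻¹) * x ^ r⁻¹ = x ^ q⁻¹ := fun x hx => by
            rw [← Real.rpow_add_of_nonneg hx (by linarith) (by positivity)]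
            congr 1
            linarith
          rw [Real.mul_rpow hX0 hW0, Real.mul_rpow (by positivity) (by positivity),
            Real.mul_rpow (by positivity) (by positivity), e4 _ hN,
            e4 _ hX0, e4 _ hW0, ← e5 _ hX0, ← e5 _ hW0]
          ring
  -- As the truncations exhaust the decompositions of the `a c`, the pairing tends to the one with
  -- the full transforms, which is `W` by the choice of `y`.
  have hFlim : Filter.Tendsto F Filter.atTop (nhds (W : ℂ)) := by
    have hval : (W : ℂ) = ∑ ξ, ∑ j, ∑ c, K ξ c * ⟪f ξ j, a c (e ξ j)⟫_ℂ * (y ξ j : ℂ) := by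
      have h1 : ∀ ξ j, ∑ c, K ξ c * ⟪f ξ j, a c (e ξ j)⟫_ℂ * (y ξ j : ℂ) =
          ((w ξ * τ ξ j : ℝ) : ℂ) := by
        intro ξ j
        rw [← Finset.sum_mul, ← hyt, mul_comm (y ξ j), Complex.ofReal_mul (t ξ j), ← hat]
        simp [sum_apply]
      simp only [h1]
      rw [hW, Complex.ofReal_sum]
      refine Finset.sum_congr rfl fun ξ _ => ?_
      rw [← Complex.ofReal_sum, ← Finset.mul_sum, ← Finset.sum_div]
      rcases (hS0 ξ).eq_or_lt with h | h
      · have : w ξ = 0 := by simp only [w, ← h]; rw [Real.zero_rpow (by positivity)]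
        simp [this]
      · rw [div_self h.ne', mul_one]
    rw [hval]
    refine tendsto_finsetSum _ fun ξ _ => tendsto_finsetSum _ fun j _ =>
      tendsto_finsetSum _ fun c _ => ?_
    have h1 := (hasSum_inner_singular (hu c) (hau c) (hker c) (e ξ j) (f ξ j)).comp
      (tendsto_eval_finset_atTop (κ := ι) c)
    have h2 := (h1.const_mul (K ξ c)).mul_const (y ξ j : ℂ)
    refine h2.congr fun I => ?_
    simp only [Function.comp_apply]
    rw [← Finset.sum_coe_sort (I c), Finset.mul_sum, Finset.sum_mul]
    exact Finset.sum_congr rfl fun i _ => by ring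
  have hWle : W ≤ N ^ r⁻¹ * X ^ q⁻¹ * W ^ q⁻¹ := by
    have := le_of_tendsto hFlim.norm (Filter.Eventually.of_forall hFbound)
    rwa [Complex.norm_real, Real.norm_of_nonneg hW0] at this
  have hX0 : 0 ≤ X := ENNReal.toReal_nonneg
  change W ≤ N * X ^ (r / q)
  -- It remains to divide by `W ^ q⁻¹`, which requires `W ≠ 0`, and to raise to the power `r`.
  rcases hW0.eq_or_lt with h | h
  · rw [← h]; positivity
  have h3 : W ^ r⁻¹ ≤ N ^ r⁻¹ * X ^ q⁻¹ := by
    have h4 : W = W ^ r⁻¹ * W ^ q⁻¹ := by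
      rw [← Real.rpow_add h, add_comm, hqr', Real.rpow_one]
    have h5 : 0 < W ^ q⁻¹ := by positivity
    refine le_of_mul_le_mul_right ?_ h5
    rwa [← h4]
  calc W = (W ^ r⁻¹) ^ r := (Real.rpow_inv_rpow h.le hr0.ne').symm
    _ ≤ (N ^ r⁻¹ * X ^ q⁻¹) ^ r := by gcongr
    _ = N * X ^ (r / q) := by
        rw [Real.mul_rpow (by positivity) (by positivity), Real.rpow_inv_rpow hN hr0.ne',
          ← Real.rpow_mul hX0]
        congr 2
        field_simp

/-- The Hausdorff-Young inequality in the Schatten class `S_q` for a matrix that is unitary up to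
scaling. -/
theorem sum_schattenSum_rpow_le {q r : ℝ} (hqr : q.HolderConjugate r) (hq2 : q ≤ 2)
    {R Q : Type*} [Fintype R] [Fintype Q] [DecidableEq Q] {K : R → Q → ℂ} {N : ℝ} (hN : 0 < N)
    (hK1 : ∀ ξ c, ‖K ξ c‖ ≤ 1)
    (hK : ∀ c d, ∑ ξ, star (K ξ c) * K ξ d = if c = d then (N : ℂ) else 0)
    {a : Q → H →L[ℂ] H} (ha : ∀ c, IsCompactOperator (a c)) :
    ∑ ξ, schattenSum q (∑ c, K ξ c • a c) ^ (r / q) ≤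
      ENNReal.ofReal N * (∑ c, schattenSum q (a c)) ^ (r / q) := by
  classical
  have hq0 : 0 < q := hqr.pos
  have hr0 : 0 < r := hqr.symm.pos
  by_cases hfin : ∑ c, schattenSum q (a c) = ∞
  · rw [hfin, ENNReal.top_rpow_of_pos (by positivity), ENNReal.mul_top (by simpa using hN)]
    exact le_top
  have hb : ∀ ξ, IsCompactOperator (∑ c, K ξ c • a c : H →L[ℂ] H) := fun ξ =>
    (compactOperator (RingHom.id ℂ) H H).sum_mem fun c _ =>
      (compactOperator (RingHom.id ℂ) H H).smul_mem _ (ha c)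
  -- The dual family is made of the singular vectors of the transforms; their finite parts are
  -- handled first, and the full Schatten sums follow in the limit.
  choose κ e f t he hf ht het _ hsum using fun ξ => exists_singular_system (hb ξ) q
  have hlim : Filter.Tendsto
      (fun I : ∀ ξ, Finset (κ ξ) => ∑ ξ, (∑ j ∈ I ξ, ENNReal.ofReal (t ξ j ^ q)) ^ (r / q))
      Filter.atTop (nhds (∑ ξ, schattenSum q (∑ c, K ξ c • a c) ^ (r / q))) := by
    refine tendsto_finsetSum _ fun ξ _ => ?_
    refine (ENNReal.continuous_rpow_const.tendsto _).comp ?_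
    rw [hsum ξ]
    exact ENNReal.summable.hasSum.comp (tendsto_eval_finset_atTop (κ := κ) ξ)
  refine le_of_tendsto hlim (Filter.Eventually.of_forall fun I => ?_)
  have h := sum_singular_rpow_le hqr hq2 hN.le hK1 hK ha hfin
    (e := fun ξ (j : I ξ) => e ξ j) (f := fun ξ (j : I ξ) => f ξ j)
    (t := fun ξ (j : I ξ) => t ξ j)
    (fun ξ => (he ξ).comp _ Subtype.val_injective)
    (fun ξ => (hf ξ).comp _ Subtype.val_injective) (fun ξ j => ht ξ j) (fun ξ j => by
      rw [het, inner_smul_right, inner_self_eq_norm_sq_to_K, (hf ξ).1]; simp)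
  have hpos : ∀ ξ, 0 ≤ ∑ j : I ξ, t ξ j ^ q := fun ξ =>
    Finset.sum_nonneg fun j _ => by have := ht ξ j; positivity
  calc ∑ ξ, (∑ j ∈ I ξ, ENNReal.ofReal (t ξ j ^ q)) ^ (r / q)
      = ENNReal.ofReal (∑ ξ, (∑ j : I ξ, t ξ j ^ q) ^ (r / q)) := by
        rw [ENNReal.ofReal_sum_of_nonneg fun ξ _ => by have := hpos ξ; positivity]
        refine Finset.sum_congr rfl fun ξ _ => ?_
        rw [← ENNReal.ofReal_rpow_of_nonneg (hpos ξ) (by positivity),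
          ENNReal.ofReal_sum_of_nonneg fun j _ => by have := ht ξ j; positivity,
          Finset.sum_coe_sort (I ξ) fun j => ENNReal.ofReal (t ξ j ^ q)]
    _ ≤ ENNReal.ofReal (N * (∑ c, schattenSum q (a c)).toReal ^ (r / q)) :=
        ENNReal.ofReal_le_ofReal h
    _ = _ := by
        rw [ENNReal.ofReal_mul hN.le,
          ← ENNReal.ofReal_rpow_of_nonneg ENNReal.toReal_nonneg (by positivity),
          ENNReal.ofReal_toReal hfin]

end FiniteHausdorffYoung

/-! ### The additive character of `ℚ_p` -/

section PadicCharacter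

variable {p : ℕ} [hp : Fact p.Prime]

/-- The additive character `x ↦ exp (-2 π i {x}_p)` of `ℚ_p`, as a plain function. -/
noncomputable def padicExp (x : ℚ_[p]) : ℂ :=
  Complex.exp (-(2 * Real.pi * Complex.I * (padicFract x : ℂ)))

theorem padicKernel_eq {n : ℕ} (ξ θ : Fin n → ℚ_[p]) :
    padicKernel ξ θ = padicExp (∑ i, ξ i * θ i) := rfl

theorem exists_padicFract_eq (x : ℚ_[p]) : ∃ (m k : ℕ),
    padicFract x = (m : ℝ) / (p : ℝ) ^ k ∧ ‖x - (m : ℚ_[p]) / (p : ℚ_[p]) ^ k‖ ≤ 1 := by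
  set k := padicPoleOrder x with hk
  let y : ℤ_[p] := ⟨x * (p : ℚ_[p]) ^ k, norm_mul_pow_padicPoleOrder_le x⟩
  refine ⟨y.appr k, k, rfl, ?_⟩
  have hp0 : (p : ℚ_[p]) ^ k ≠ 0 := pow_ne_zero _ (by exact_mod_cast hp.out.ne_zero)
  obtain ⟨z, hz⟩ := Ideal.mem_span_singleton.1 (PadicInt.appr_spec k y)
  have hz' : x * (p : ℚ_[p]) ^ k - (y.appr k : ℚ_[p]) = (p : ℚ_[p]) ^ k * (z : ℚ_[p]) := by
    have := congrArg (fun w : ℤ_[p] => (w : ℚ_[p])) hz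
    push_cast at this
    exact this
  have : x - (y.appr k : ℚ_[p]) / (p : ℚ_[p]) ^ k = z := by
    field_simp
    linear_combination hz'
  rw [this]
  exact z.2

/-- The character may be computed from any fraction with denominator a power of `p` that is
congruent to `x` modulo `ℤ_p`: two such fractions differ by an element of `ℤ[1/p] ∩ ℤ_p = ℤ`,
invisible to the exponential. Additivity follows without any carrying of digits. -/
theorem padicExp_eq_of_norm_sub_le {x : ℚ_[p]} {a : ℤ} {k : ℕ}
    (h : ‖x - (a : ℚ_[p]) / (p : ℚ_[p]) ^ k‖ ≤ 1) :
    padicExp x = Complex.exp (-(2 * Real.pi * Complex.I * ((a : ℂ) / (p : ℂ) ^ k))) := by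
  obtain ⟨m, j, hm, hx⟩ := exists_padicFract_eq x
  have hpQ : (p : ℚ_[p]) ≠ 0 := by exact_mod_cast hp.out.ne_zero
  have hpC : (p : ℂ) ≠ 0 := by exact_mod_cast hp.out.ne_zero
  have h1 : ‖(a : ℚ_[p]) / (p : ℚ_[p]) ^ k - (m : ℚ_[p]) / (p : ℚ_[p]) ^ j‖ ≤ 1 := by
    have h2 := Padic.nonarchimedean (x - (m : ℚ_[p]) / (p : ℚ_[p]) ^ j)
      (-(x - (a : ℚ_[p]) / (p : ℚ_[p]) ^ k))
    rw [norm_neg] at h2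
    refine le_trans (le_of_eq ?_) (h2.trans (max_le hx h))
    congr 1
    ring
  have h3 : ‖((a * p ^ j - m * p ^ k : ℤ) : ℚ_[p])‖ ≤ (p : ℝ) ^ (-((k + j : ℕ) : ℤ)) := by
    have h4 : ((a * p ^ j - m * p ^ k : ℤ) : ℚ_[p]) =
        ((a : ℚ_[p]) / (p : ℚ_[p]) ^ k - (m : ℚ_[p]) / (p : ℚ_[p]) ^ j) * (p : ℚ_[p]) ^ (k + j) := by
      push_cast
      field_simp
      ring
    rw [h4, norm_mul, Padic.norm_p_pow]
    exact mul_le_of_le_one_left (by positivity) h1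
  obtain ⟨d, hd⟩ := (Padic.norm_int_le_pow_iff_dvd _ _).1 h3
  have h5 : (a : ℂ) / (p : ℂ) ^ k = (m : ℂ) / (p : ℂ) ^ j + d := by
    have : ((a * p ^ j - m * p ^ k : ℤ) : ℂ) = ((p ^ (k + j) * d : ℤ) : ℂ) := by rw [hd]
    push_cast at this
    field_simp
    linear_combination this
  rw [padicExp, hm, h5, Complex.exp_eq_exp_iff_exists_int]
  exact ⟨d, by push_cast; ring⟩

theorem padicExp_of_norm_le_one {x : ℚ_[p]} (hx : ‖x‖ ≤ 1) : padicExp x = 1 := by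
  rw [padicExp_eq_of_norm_sub_le (a := 0) (k := 0) (by simpa using hx)]
  simp

theorem padicExp_add (x y : ℚ_[p]) : padicExp (x + y) = padicExp x * padicExp y := by
  obtain ⟨a, k, -, hx⟩ := exists_padicFract_eq x
  obtain ⟨b, l, -, hy⟩ := exists_padicFract_eq y
  have hpQ : (p : ℚ_[p]) ≠ 0 := by exact_mod_cast hp.out.ne_zero
  have hpC : (p : ℂ) ≠ 0 := by exact_mod_cast hp.out.ne_zero
  have hxy : ‖x + y - ((a * p ^ l + b * p ^ k : ℤ) : ℚ_[p]) / (p : ℚ_[p]) ^ (k + l)‖ ≤ 1 := by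
    refine le_trans (le_of_eq ?_) ((Padic.nonarchimedean _ _).trans (max_le hx hy))
    congr 1
    push_cast
    field_simp
    ring
  have hx' : ‖x - ((a : ℤ) : ℚ_[p]) / (p : ℚ_[p]) ^ k‖ ≤ 1 := by rwa [Int.cast_natCast]
  have hy' : ‖y - ((b : ℤ) : ℚ_[p]) / (p : ℚ_[p]) ^ l‖ ≤ 1 := by rwa [Int.cast_natCast]
  rw [padicExp_eq_of_norm_sub_le hxy, padicExp_eq_of_norm_sub_le hx',
    padicExp_eq_of_norm_sub_le hy', ← Complex.exp_add]
  congr 1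
  push_cast
  field_simp
  ring

theorem padicExp_inv_prime_ne_one : padicExp ((p : ℚ_[p])⁻¹) ≠ 1 := by
  rw [padicExp_eq_of_norm_sub_le (a := 1) (k := 1) (by simp), Ne, Complex.exp_eq_one_iff]
  rintro ⟨m, hm⟩
  have hpC : (p : ℂ) ≠ 0 := by exact_mod_cast hp.out.ne_zero
  have h1 : (1 : ℂ) = -m * p := by
    have : (2 * Real.pi * Complex.I : ℂ) ≠ 0 := Complex.two_pi_I_ne_zero
    have h2 : (2 * Real.pi * Complex.I : ℂ) * (-(1 / p)) = (2 * Real.pi * Complex.I) * m := by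
      push_cast at hm
      linear_combination hm
    have h3 := mul_left_cancel₀ this h2
    rw [← h3]
    field_simp
  have h2 : (p : ℤ) ∣ 1 := ⟨-m, by
    have : (1 : ℤ) = -m * p := by exact_mod_cast h1
    linarith⟩
  exact hp.out.one_lt.ne' (by exact_mod_cast Int.eq_one_of_dvd_one (by positivity) h2)

theorem norm_padicExp (x : ℚ_[p]) : ‖padicExp x‖ = 1 := by
  rw [padicExp, Complex.norm_exp]
  simp

/-- The character is locally constant, being trivial on the open subgroup `ℤ_p`. -/
theorem continuous_padicExp : Continuous (padicExp : ℚ_[p] → ℂ) := by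
  refine continuous_iff_continuousAt.2 fun x => ?_
  refine (continuousAt_const (y := padicExp x)).congr ?_
  filter_upwards [Metric.closedBall_mem_nhds x one_pos] with y hy
  have h : padicExp (x + (y - x)) = padicExp x * padicExp (y - x) := padicExp_add _ _
  rw [padicExp_of_norm_le_one (x := y - x) (by simpa [dist_eq_norm] using hy), mul_one] at h
  rw [← h]
  congr 1
  ring

variable {n : ℕ}

theorem norm_padicKernel (ξ θ : Fin n → ℚ_[p]) : ‖padicKernel ξ θ‖ = 1 := norm_padicExp _

theorem padicKernel_add_left (ξ η θ : Fin n → ℚ_[p]) :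
    padicKernel (ξ + η) θ = padicKernel ξ θ * padicKernel η θ := by
  simp only [padicKernel_eq, ← padicExp_add, ← Finset.sum_add_distrib, Pi.add_apply, add_mul]

theorem padicKernel_add_right (ξ θ η : Fin n → ℚ_[p]) :
    padicKernel ξ (θ + η) = padicKernel ξ θ * padicKernel ξ η := by
  simp only [padicKernel_eq, ← padicExp_add, ← Finset.sum_add_distrib, Pi.add_apply, mul_add]

theorem star_padicKernel_mul (ξ θ η : Fin n → ℚ_[p]) :
    star (padicKernel ξ θ) * padicKernel ξ η = padicKernel ξ (η - θ) := by
  have h : padicKernel ξ (η - θ) * padicKernel ξ θ = padicKernel ξ η := by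
    rw [← padicKernel_add_right, sub_add_cancel]
  rw [← h, mul_left_comm, mul_comm (star _), Complex.star_def, Complex.mul_conj',
    norm_padicKernel]
  simp

theorem continuous_padicKernel_right (ξ : Fin n → ℚ_[p]) : Continuous (padicKernel ξ) :=
  continuous_padicExp.comp (f := fun θ : Fin n → ℚ_[p] => ∑ i, ξ i * θ i) (by fun_prop)

theorem continuous_padicKernel_left (θ : Fin n → ℚ_[p]) : Continuous fun ξ => padicKernel ξ θ :=
  continuous_padicExp.comp (f := fun ξ : Fin n → ℚ_[p] => ∑ i, ξ i * θ i) (by fun_prop)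

/-! ### Lattices in `ℚ_p ^ n`, their duality and their Haar measure -/

variable (p n) in
/-- The subgroup of `ℚ_p ^ n` of vectors with all coordinates of norm at most `p ^ k`. -/
def padicLattice (k : ℤ) : AddSubgroup (Fin n → ℚ_[p]) where
  carrier := {x | ∀ i, ‖x i‖ ≤ (p : ℝ) ^ k}
  zero_mem' i := by simp; positivity
  add_mem' hx hy i := (Padic.nonarchimedean _ _).trans (max_le (hx i) (hy i))
  neg_mem' hx i := by simpa using hx i

theorem mem_padicLattice {k : ℤ} {x : Fin n → ℚ_[p]} :
    x ∈ padicLattice p n k ↔ ∀ i, ‖x i‖ ≤ (p : ℝ) ^ k := Iff.rfl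

theorem coe_padicLattice (k : ℤ) :
    (padicLattice p n k : Set (Fin n → ℚ_[p])) = Metric.closedBall 0 ((p : ℝ) ^ k) := by
  ext x
  rw [SetLike.mem_coe, mem_padicLattice, mem_closedBall_zero_iff,
    pi_norm_le_iff_of_nonneg (by positivity)]

theorem isCompact_padicLattice (k : ℤ) : IsCompact (padicLattice p n k : Set (Fin n → ℚ_[p])) := by
  rw [coe_padicLattice]
  exact isCompact_closedBall _ _

theorem isOpen_padicLattice (k : ℤ) : IsOpen (padicLattice p n k : Set (Fin n → ℚ_[p])) := by
  have hp0 : (0 : ℝ) < p := by exact_mod_cast hp.out.pos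
  refine AddSubgroup.isOpen_of_mem_nhds _ (g := 0) ?_
  rw [coe_padicLattice]
  exact Metric.closedBall_mem_nhds _ (by positivity)

theorem measurableSet_padicLattice (k : ℤ) :
    MeasurableSet (padicLattice p n k : Set (Fin n → ℚ_[p])) :=
  (isOpen_padicLattice k).measurableSet

theorem monotone_padicLattice : Monotone (padicLattice p n) := fun _ _ hkl _ hx i =>
  (hx i).trans (zpow_le_zpow_right₀ (by exact_mod_cast hp.out.one_lt.le) hkl)

theorem iUnion_padicLattice :
    ⋃ k : ℕ, (padicLattice p n k : Set (Fin n → ℚ_[p])) = Set.univ := by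
  refine Set.eq_univ_of_forall fun x => Set.mem_iUnion.2 ?_
  obtain ⟨k, hk⟩ := pow_unbounded_of_one_lt ‖x‖ (by exact_mod_cast hp.out.one_lt : (1 : ℝ) < p)
  refine ⟨k, ?_⟩
  rw [coe_padicLattice, mem_closedBall_zero_iff]
  simpa using hk.le

theorem padicKernel_eq_one {k : ℤ} {ξ θ : Fin n → ℚ_[p]} (hξ : ξ ∈ padicLattice p n k)
    (hθ : θ ∈ padicLattice p n (-k)) : padicKernel ξ θ = 1 := by
  have hp0 : (p : ℝ) ≠ 0 := by exact_mod_cast hp.out.ne_zero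
  refine padicExp_of_norm_le_one ?_
  refine IsUltrametricDist.norm_sum_le_of_forall_le_of_nonneg zero_le_one fun i _ => ?_
  rw [norm_mul]
  calc ‖ξ i‖ * ‖θ i‖ ≤ (p : ℝ) ^ k * (p : ℝ) ^ (-k) := by gcongr; exacts [hξ i, hθ i]
    _ = 1 := by rw [← zpow_add₀ hp0]; simp

/-- The annihilator of the lattice `p ^ (-k) ℤ_p ^ n` is contained in `p ^ k ℤ_p ^ n`. -/
theorem exists_padicKernel_ne_one {k : ℤ} {θ : Fin n → ℚ_[p]} (hθ : θ ∉ padicLattice p n (-k)) :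
    ∃ ξ ∈ padicLattice p n k, padicKernel ξ θ ≠ 1 := by
  classical
  have hp0 : (0 : ℝ) < p := by exact_mod_cast hp.out.pos
  rw [mem_padicLattice] at hθ
  push Not at hθ
  obtain ⟨i, hi⟩ := hθ
  have hi0 : θ i ≠ 0 := fun h => by rw [h, norm_zero] at hi; exact hi.not_ge (by positivity)
  -- Norms are powers of `p`, so exceeding `p ^ (-k)` means reaching `p ^ (-k + 1)`. This gap makes
  -- room for the factor `p⁻¹` in the witness, which pairs with `θ` to exactly `p⁻¹`.
  have hi' : (p : ℝ) ^ (-k + 1) ≤ ‖θ i‖ := by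
    by_contra! h
    exact hi.not_ge ((Padic.norm_le_pow_iff_norm_lt_pow_add_one _ _).2 h)
  refine ⟨Pi.single i ((p : ℚ_[p])⁻¹ * (θ i)⁻¹), fun j => ?_, ?_⟩
  · rcases eq_or_ne j i with rfl | hj
    · rw [Pi.single_eq_same, norm_mul, norm_inv, norm_inv, Padic.norm_p, inv_inv]
      rw [← div_eq_mul_inv, div_le_iff₀ (norm_pos_iff.2 hi0)]
      calc (p : ℝ) = (p : ℝ) ^ k * (p : ℝ) ^ (-k + 1) := by
            rw [← zpow_add₀ hp0.ne']; simp
        _ ≤ _ := by gcongr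
    · rw [Pi.single_eq_of_ne hj, norm_zero]; positivity
  · rw [padicKernel_eq]
    have : ∑ j, (Pi.single i ((p : ℚ_[p])⁻¹ * (θ i)⁻¹) : Fin n → ℚ_[p]) j * θ j =
        (p : ℚ_[p])⁻¹ := by
      rw [Finset.sum_eq_single i (fun j _ hj => by rw [Pi.single_eq_of_ne hj, zero_mul]) (by simp),
        Pi.single_eq_same, mul_assoc, inv_mul_cancel₀ hi0, mul_one]
    rw [this]
    exact padicExp_inv_prime_ne_one

instance padicHaar.instIsAddHaarMeasure : (padicHaar p n).IsAddHaarMeasure := by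
  unfold padicHaar
  infer_instance

theorem padicHaar_padicLattice_zero : padicHaar p n (padicLattice p n 0) = 1 := by
  have : (padicLattice p n 0 : Set (Fin n → ℚ_[p])) = padicPolydisc p n := by
    ext x
    simp only [SetLike.mem_coe, mem_padicLattice, zpow_zero]
    rfl
  rw [this]
  exact Measure.addHaarMeasure_self

/-- The normalization of the Haar measure is self-dual. -/
theorem padicHaar_padicLattice_mul (k : ℤ) :
    padicHaar p n (padicLattice p n k) * padicHaar p n (padicLattice p n (-k)) = 1 := by
  have hp0 : (p : ℝ) ≠ 0 := by exact_mod_cast hp.out.ne_zero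
  have hpQ : (p : ℚ_[p]) ^ k ≠ 0 := zpow_ne_zero _ (by exact_mod_cast hp.out.ne_zero)
  let g : (Fin n → ℚ_[p]) ≃L[ℚ_[p]] (Fin n → ℚ_[p]) :=
    ContinuousLinearEquiv.smulLeft (Units.mk0 _ hpQ)
  have hg : ∀ x i, g x i = (p : ℚ_[p]) ^ k * x i := fun x i => rfl
  have hpre : ∀ l, g ⁻¹' (padicLattice p n l) = padicLattice p n (k + l) := by
    intro l
    ext x
    simp only [Set.mem_preimage, SetLike.mem_coe, mem_padicLattice, hg, norm_mul,
      Padic.norm_p_zpow, zpow_neg]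
    refine forall_congr' fun i => ?_
    rw [inv_mul_le_iff₀ (by positivity), ← zpow_add₀ hp0]
  have hgm : Measurable g := g.continuous.measurable
  have hmap : ((padicHaar p n).map g).IsAddHaarMeasure :=
    ContinuousAddEquiv.isAddHaarMeasure_map (padicHaar p n) g.toContinuousAddEquiv
  -- By uniqueness of Haar measure, multiplication by `p ^ k` scales volumes by a constant `c`.
  -- Testing on the lattices of level `0` and `-k` identifies the two factors as `c` and its
  -- inverse.
  have h := Measure.isAddLeftInvariant_eq_smul ((padicHaar p n).map g) (padicHaar p n)
  set c := Measure.addHaarScalarFactor ((padicHaar p n).map g) (padicHaar p n)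
  have h0 := congrArg (fun μ => μ (padicLattice p n 0 : Set (Fin n → ℚ_[p]))) h
  have h1 := congrArg (fun μ => μ (padicLattice p n (-k) : Set (Fin n → ℚ_[p]))) h
  simp only [Measure.map_apply hgm (measurableSet_padicLattice _), hpre, add_zero,
    add_neg_cancel, padicHaar_padicLattice_zero, Measure.smul_apply] at h0 h1
  rw [h0, ENNReal.smul_def, smul_eq_mul, mul_one, h1, ENNReal.smul_def, smul_eq_mul]

/-- Representatives of the cosets of `p ^ k ℤ_p ^ n` in `p ^ (-k) ℤ_p ^ n`. -/
theorem exists_padicLattice_representatives (k : ℤ) :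
    ∃ (Q : Type) (_ : Fintype Q) (_ : DecidableEq Q) (x : Q → Fin n → ℚ_[p]),
      (∀ c, x c ∈ padicLattice p n k) ∧
      ∀ y ∈ padicLattice p n k, ∃! c, y - x c ∈ padicLattice p n (-k) := by
  classical
  let D := padicLattice p n k
  let L := (padicLattice p n (-k)).addSubgroupOf D
  have : CompactSpace D := isCompact_iff_compactSpace.1 (isCompact_padicLattice k)
  have hL : IsOpen (L : Set D) := (isOpen_padicLattice (-k)).preimage continuous_subtype_val
  -- An open subgroup of a compact group has finite index.
  have hfin : Finite (D ⧸ L) := AddSubgroup.quotient_finite_of_isOpen L hL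
  have hmem : ∀ (y : D) (c : D ⧸ L), (y : Fin n → ℚ_[p]) - (c.out : D) ∈ padicLattice p n (-k) ↔
      (y : D ⧸ L) = c := by
    intro y c
    conv_rhs => rw [← QuotientAddGroup.out_eq' c]
    rw [eq_comm, QuotientAddGroup.eq, AddSubgroup.mem_addSubgroupOf]
    push_cast
    rw [neg_add_eq_sub]
  obtain ⟨N, ⟨φ⟩⟩ := Finite.exists_equiv_fin (D ⧸ L)
  refine ⟨Fin N, inferInstance, inferInstance, fun c => ((φ.symm c).out : D), fun c => Subtype.prop _,
    fun y hy => ⟨φ (⟨y, hy⟩ : D), ?_, fun c hc => ?_⟩⟩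
  · refine (hmem ⟨y, hy⟩ _).2 ?_
    simp
  · rw [(hmem ⟨y, hy⟩ _).1 hc]
    simp

/-- Orthogonality of characters of a finite quotient of lattices. -/
theorem sum_star_padicKernel_mul {k : ℤ} {Q : Type*} [Fintype Q] [DecidableEq Q]
    {x : Q → Fin n → ℚ_[p]} (hx : ∀ c, x c ∈ padicLattice p n k)
    (hrep : ∀ y ∈ padicLattice p n k, ∃! c, y - x c ∈ padicLattice p n (-k)) (c d : Q) :
    ∑ ξ, star (padicKernel (x ξ) (x c)) * padicKernel (x ξ) (x d) =
      if c = d then ((Fintype.card Q : ℝ) : ℂ) else 0 := by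
  simp only [star_padicKernel_mul]
  split_ifs with hcd
  · subst hcd
    have h : ∀ ξ, padicKernel (x ξ) (x c - x c) = 1 := fun ξ =>
      padicKernel_eq_one (hx ξ) (by rw [sub_self]; exact zero_mem _)
    simp only [h]
    simp
  · set θ := x d - x c
    have hθk : θ ∈ padicLattice p n k := sub_mem (hx d) (hx c)
    have hθn : θ ∉ padicLattice p n (-k) := fun h =>
      hcd ((hrep (x d) (hx d)).unique h (by rw [sub_self]; exact zero_mem _))
    obtain ⟨η, hη, hne⟩ := exists_padicKernel_ne_one hθn
    -- Translation by `η` permutes the cosets, so the character sum equals itself times `padicKernel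
    -- η θ ≠ 1` and must vanish.
    choose g hg _ using fun ξ : Q => hrep (x ξ + η) (add_mem (hx ξ) hη)
    have hginj : Function.Injective g := by
      intro ξ ξ' h
      refine (hrep (x ξ) (hx ξ)).unique (y₁ := ξ) (y₂ := ξ') (by rw [sub_self]; exact zero_mem _) ?_
      have h1 := hg ξ'
      rw [← h] at h1
      have h2 := sub_mem (hg ξ) h1
      have h3 : x ξ + η - x (g ξ) - (x ξ' + η - x (g ξ)) = x ξ - x ξ' := by abel
      rwa [h3] at h2
    have hgb : Function.Bijective g := Finite.injective_iff_bijective.1 hginj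
    have hS : padicKernel η θ * ∑ ξ, padicKernel (x ξ) θ = ∑ ξ, padicKernel (x ξ) θ := by
      conv_rhs => rw [← hgb.sum_comp]
      rw [Finset.mul_sum]
      refine Finset.sum_congr rfl fun ξ _ => ?_
      rw [mul_comm, ← padicKernel_add_left, ← sub_add_cancel (x ξ + η) (x (g ξ)),
        padicKernel_add_left, padicKernel_eq_one (k := -k) (hg ξ) (by rwa [neg_neg]), one_mul]
    have h1 : (padicKernel η θ - 1) * ∑ ξ, padicKernel (x ξ) θ = 0 := by
      rw [sub_mul, hS, one_mul, sub_self]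
    exact (mul_eq_zero.1 h1).resolve_left (sub_ne_zero.2 hne)

end PadicCharacter

/-- Hölder's inequality against the constant function `1`. -/
theorem rpow_lintegral_le {α : Type*} {m : MeasurableSpace α} (μ : Measure α) {q r : ℝ}
    (hqr : q.HolderConjugate r) {f : α → ℝ≥0∞} (hf : AEMeasurable f μ) :
    (∫⁻ x, f x ∂μ) ^ q ≤ μ Set.univ ^ (q - 1) * ∫⁻ x, f x ^ q ∂μ := by
  have hq0 : 0 < q := hqr.pos
  have hr0 : 0 < r := hqr.symm.pos
  have h := ENNReal.lintegral_mul_le_Lp_mul_Lq μ hqr hf (aemeasurable_const (b := (1 : ℝ≥0∞)))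
  simp only [Pi.mul_apply, mul_one, ENNReal.one_rpow, lintegral_one] at h
  refine (ENNReal.rpow_le_rpow h hq0.le).trans_eq ?_
  have hqr' : q⁻¹ + r⁻¹ = 1 := by simpa using hqr.inv_add_inv_eq_one
  have e : 1 / r * q = q - 1 := by
    field_simp at hqr' ⊢
    linarith
  rw [ENNReal.mul_rpow_of_nonneg _ _ hq0.le, ← ENNReal.rpow_mul, ← ENNReal.rpow_mul, e,
    one_div_mul_cancel hq0.ne', ENNReal.rpow_one, mul_comm]

namespace SchattenClass

variable {H : Type*} [NormedAddCommGroup H] [InnerProductSpace ℂ H] [CompleteSpace H]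
  {q : ℝ} [hq : Fact (1 ≤ q)]

theorem enorm_rpow (A : SchattenClass H q) : ‖A‖ₑ ^ q = schattenSum q (toOp H q A) := by
  have hq0 : 0 < q := by linarith [hq.out]
  rw [← ofReal_norm, ofReal_norm_eq, one_div, ENNReal.rpow_inv_rpow hq0.ne']

/-- The Hausdorff-Young inequality in `S_q` for a matrix that is unitary up to scaling. -/
theorem sum_enorm_rpow_le {r : ℝ} (hqr : q.HolderConjugate r) (hq2 : q ≤ 2)
    {R Q : Type*} [Fintype R] [Fintype Q] [DecidableEq Q] {K : R → Q → ℂ} {N : ℝ} (hN : 0 < N)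
    (hK1 : ∀ ξ c, ‖K ξ c‖ ≤ 1)
    (hK : ∀ c d, ∑ ξ, star (K ξ c) * K ξ d = if c = d then (N : ℂ) else 0)
    (a : Q → SchattenClass H q) :
    ∑ ξ, ‖∑ c, K ξ c • a c‖ₑ ^ r ≤ ENNReal.ofReal N * (∑ c, ‖a c‖ₑ ^ q) ^ (r / q) := by
  have hq0 : 0 < q := hqr.pos
  have h := sum_schattenSum_rpow_le hqr hq2 hN hK1 hK fun c => (a c).isCompactOperator
  simp only [← enorm_rpow] at h
  refine le_of_eq_of_le (Finset.sum_congr rfl fun ξ _ => ?_) h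
  have h1 : ∑ c, K ξ c • toOp H q (a c) = toOp H q (∑ c, K ξ c • a c) := by
    simp only [map_sum, map_smul]
  rw [h1, ← enorm_rpow, ← ENNReal.rpow_mul, mul_div_cancel₀ _ hq0.ne']

end SchattenClass

/-! ### The Fourier transform on `ℚ_p ^ n`: discretization and limit -/

section PadicFourier

variable {p : ℕ} [hp : Fact p.Prime] {n : ℕ}
  {H : Type*} [NormedAddCommGroup H] [InnerProductSpace ℂ H] [CompleteSpace H]
  {q : ℝ} [hq : Fact (1 ≤ q)] {A : (Fin n → ℚ_[p]) → SchattenClass H q}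

theorem aestronglyMeasurable_padicKernel_smul {μ : Measure (Fin n → ℚ_[p])}
    (hA : AEStronglyMeasurable A μ) (ξ : Fin n → ℚ_[p]) :
    AEStronglyMeasurable (fun θ => padicKernel ξ θ • A θ) μ := 
  (continuous_padicKernel_right ξ).aestronglyMeasurable.smul hA

theorem integrable_padicKernel_smul {μ : Measure (Fin n → ℚ_[p])} (hA : Integrable A μ)
    (ξ : Fin n → ℚ_[p]) : Integrable (fun θ => padicKernel ξ θ • A θ) μ :=
  hA.mono (aestronglyMeasurable_padicKernel_smul hA.1 ξ) <| Filter.Eventually.of_forall fun θ => by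
    rw [norm_smul, norm_padicKernel, one_mul]

/-- Dominated convergence. Its use is to make the transform, and its truncations in Fatou's lemma,
measurable. -/
theorem continuous_integral_padicKernel_smul {μ : Measure (Fin n → ℚ_[p])} (hA : Integrable A μ) :
    Continuous fun ξ => ∫ θ, padicKernel ξ θ • A θ ∂μ := by
  refine continuous_of_dominated (bound := fun θ => ‖A θ‖)
    (fun ξ => aestronglyMeasurable_padicKernel_smul hA.1 ξ)
    (fun ξ => Filter.Eventually.of_forall fun θ => ?_) hA.norm
    (Filter.Eventually.of_forall fun θ => ?_)
  · rw [norm_smul, norm_padicKernel, one_mul]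
  · exact (continuous_padicKernel_left θ).smul continuous_const

theorem enorm_padicFourier_le (A : (Fin n → ℚ_[p]) → SchattenClass H q) (ξ : Fin n → ℚ_[p]) :
    ‖padicFourier A ξ‖ₑ ≤ ∫⁻ θ, ‖A θ‖ₑ ∂(padicHaar p n) := by
  refine (enorm_integral_le_lintegral_enorm _).trans_eq (lintegral_congr fun θ => ?_)
  rw [enorm_smul, ← ofReal_norm (padicKernel ξ θ), norm_padicKernel, ENNReal.ofReal_one, one_mul]

/-- The Hausdorff-Young inequality on the lattice `p ^ (-k) ℤ_p ^ n`, where the Fourier transform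
is a finite one. -/
theorem setLIntegral_enorm_rpow_le {r : ℝ} (hqr : q.HolderConjugate r) (hq2 : q ≤ 2)
    (hA : Integrable A (padicHaar p n)) (k : ℕ) :
    ∫⁻ ξ in padicLattice p n k,
        ‖∫ θ in padicLattice p n k, padicKernel ξ θ • A θ ∂(padicHaar p n)‖ₑ ^ r ∂(padicHaar p n) ≤
      (∫⁻ θ, ‖A θ‖ₑ ^ q ∂(padicHaar p n)) ^ (r / q) := by
  have hq0 : 0 < q := hqr.pos
  have hr0 : 0 < r := hqr.symm.pos
  set μ := padicHaar p n with hμ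
  obtain ⟨Q, _, _, x, hx, hrep⟩ := exists_padicLattice_representatives (p := p) (n := n) k
  set m := μ (padicLattice p n (-k)) with hm
  let C : Q → Set (Fin n → ℚ_[p]) := fun c => {y | y - x c ∈ padicLattice p n (-k)}
  have hCpre : ∀ c, C c = (fun y => y + -x c) ⁻¹' (padicLattice p n (-k)) := fun c => by
    ext y; simp [C, sub_eq_add_neg]
  have hCmeas : ∀ c, MeasurableSet (C c) := fun c => by
    rw [hCpre]
    exact (measurableSet_padicLattice _).preimage (measurable_add_const _)
  have hCm : ∀ c, μ (C c) = m := fun c => by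
    rw [hCpre, measure_preimage_add_right]
  have hLD : padicLattice p n (-(k : ℤ)) ≤ padicLattice p n k := monotone_padicLattice (by omega)
  have hCD : ∀ c, C c ⊆ padicLattice p n k := fun c y hy => by
    have := add_mem (hLD hy) (hx c)
    rwa [sub_add_cancel] at this
  have hCunion : (padicLattice p n k : Set (Fin n → ℚ_[p])) = ⋃ c, C c := by
    refine Set.Subset.antisymm (fun y hy => ?_) (Set.iUnion_subset hCD)
    obtain ⟨c, hc, -⟩ := hrep y hy
    exact Set.mem_iUnion.2 ⟨c, hc⟩
  have hCdisj : Pairwise (Function.onFun Disjoint C) := fun c d hcd =>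
    Set.disjoint_left.2 fun y hc hd => hcd ((hrep y (hCD c hc)).unique hc hd)
  -- The larger lattice is a disjoint union of `card Q` translates of the smaller, so self-duality
  -- of the measure reads `card Q * m * m = 1`.
  have hcard : (Fintype.card Q : ℝ≥0∞) * m * m = 1 := by
    rw [← padicHaar_padicLattice_mul (p := p) (n := n) k, ← hμ, ← hm, hCunion,
      measure_iUnion hCdisj hCmeas]
    simp [hCm]
  have hcard0 : 0 < (Fintype.card Q : ℝ) := by
    rcases Nat.eq_zero_or_pos (Fintype.card Q) with h | h
    · simp [h] at hcard
    · exact_mod_cast h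
  have hK : ∀ c d, ∀ ξ ∈ C c, ∀ θ ∈ C d, padicKernel ξ θ = padicKernel (x c) (x d) := by
    intro c d ξ hξ θ hθ
    rw [← sub_add_cancel ξ (x c), padicKernel_add_left,
      padicKernel_eq_one (k := -k) hξ (by rw [neg_neg]; exact hCD d hθ), one_mul,
      ← sub_add_cancel θ (x d), padicKernel_add_right, padicKernel_eq_one (hx c) hθ, one_mul]
  let a : Q → SchattenClass H q := fun c => ∫ θ in C c, A θ ∂μ
  have hB : ∀ c, ∀ ξ ∈ C c, ∫ θ in padicLattice p n k, padicKernel ξ θ • A θ ∂μ =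
      ∑ d, padicKernel (x c) (x d) • a d := by
    intro c ξ hξ
    rw [hCunion, integral_iUnion_fintype hCmeas hCdisj fun d =>
      (integrable_padicKernel_smul hA ξ).integrableOn]
    refine Finset.sum_congr rfl fun d _ => ?_
    rw [setIntegral_congr_fun (g := fun θ => padicKernel (x c) (x d) • A θ) (hCmeas d)
      fun θ hθ => by simp only [hK c d ξ hξ θ hθ], integral_smul]
  have ha : ∀ c, ‖a c‖ₑ ^ q ≤ m ^ (q - 1) * ∫⁻ θ in C c, ‖A θ‖ₑ ^ q ∂μ := by
    intro c
    refine (ENNReal.rpow_le_rpow (enorm_integral_le_lintegral_enorm _) hq0.le).trans ?_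
    have h := rpow_lintegral_le (μ.restrict (C c)) hqr hA.1.enorm.restrict
    rwa [Measure.restrict_apply_univ, hCm] at h
  have hsum : ∑ c, ‖a c‖ₑ ^ q ≤ m ^ (q - 1) * ∫⁻ θ, ‖A θ‖ₑ ^ q ∂μ := by
    refine (Finset.sum_le_sum fun c _ => ha c).trans ?_
    rw [← Finset.mul_sum, ← tsum_fintype (L := .unconditional Q), ← lintegral_iUnion hCmeas hCdisj]
    gcongr
    exact Measure.restrict_le_self
  calc ∫⁻ ξ in padicLattice p n k, ‖∫ θ in padicLattice p n k, padicKernel ξ θ • A θ ∂μ‖ₑ ^ r ∂μ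
      = ∑ c, ∫⁻ ξ in C c, ‖∫ θ in padicLattice p n k, padicKernel ξ θ • A θ ∂μ‖ₑ ^ r ∂μ := by
        rw [← tsum_fintype (L := .unconditional Q), ← lintegral_iUnion hCmeas hCdisj, ← hCunion]
    _ = (∑ c, ‖∑ d, padicKernel (x c) (x d) • a d‖ₑ ^ r) * m := by
        rw [Finset.sum_mul]
        refine Finset.sum_congr rfl fun c _ => ?_
        rw [setLIntegral_congr_fun (g := fun _ => ‖∑ d, padicKernel (x c) (x d) • a d‖ₑ ^ r)
          (hCmeas c) fun ξ hξ => by simp only [hB c ξ hξ], setLIntegral_const, hCm]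
    _ ≤ (ENNReal.ofReal (Fintype.card Q) * (m ^ (q - 1) * ∫⁻ θ, ‖A θ‖ₑ ^ q ∂μ) ^ (r / q)) * m := by
        gcongr
        refine (SchattenClass.sum_enorm_rpow_le hqr hq2 hcard0
          (fun c d => (norm_padicKernel _ _).le) (sum_star_padicKernel_mul hx hrep) a).trans ?_
        gcongr
    -- One factor `m` is the volume of a coset in the variable `ξ`; the other comes from Hölder on
    -- the cosets in `θ`, as `(q - 1) * (r / q) = 1`. Together they cancel `card Q`.
    _ = (Fintype.card Q * m * m) * (∫⁻ θ, ‖A θ‖ₑ ^ q ∂μ) ^ (r / q) := by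
        have e : (q - 1) * (r / q) = 1 := by
          have := hqr.sub_one_mul_conj
          field_simp
          linarith
        rw [ENNReal.mul_rpow_of_nonneg _ _ (by positivity), ← ENNReal.rpow_mul, e,
          ENNReal.rpow_one, ENNReal.ofReal_natCast]
        ring
    _ = _ := by rw [hcard, one_mul]

/-- The Hausdorff-Young inequality for the operator-valued Fourier transform on `ℚ_p ^ n`. -/
theorem lintegral_enorm_padicFourier_rpow_le {r : ℝ} (hqr : q.HolderConjugate r) (hq2 : q ≤ 2)
    (hA : Integrable A (padicHaar p n)) :
    ∫⁻ ξ, ‖padicFourier A ξ‖ₑ ^ r ∂(padicHaar p n) ≤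
      (∫⁻ θ, ‖A θ‖ₑ ^ q ∂(padicHaar p n)) ^ (r / q) := by
  set μ := padicHaar p n with hμ
  let B : ℕ → (Fin n → ℚ_[p]) → SchattenClass H q := fun k ξ =>
    ∫ θ in padicLattice p n k, padicKernel ξ θ • A θ ∂μ
  -- Both variables are cut off to the same lattice. For a fixed `ξ` the indicator is eventually
  -- one, so `F k ξ` still tends to the full transform and Fatou's lemma applies.
  let F : ℕ → (Fin n → ℚ_[p]) → ℝ≥0∞ := fun k =>
    (padicLattice p n k : Set (Fin n → ℚ_[p])).indicator fun ξ => ‖B k ξ‖ₑ ^ r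
  have hmono : Monotone fun k : ℕ => (padicLattice p n k : Set (Fin n → ℚ_[p])) := fun k l hkl =>
    monotone_padicLattice (by exact_mod_cast hkl)
  have hFmeas : ∀ k, Measurable (F k) := fun k => by
    refine Measurable.indicator ?_ (measurableSet_padicLattice _)
    have h := continuous_integral_padicKernel_smul (μ := μ.restrict (padicLattice p n k))
      hA.integrableOn
    exact (ENNReal.continuous_rpow_const.comp (continuous_enorm.comp h)).measurable
  have hlim : ∀ ξ, Filter.Tendsto (fun k => F k ξ) Filter.atTop
      (nhds (‖padicFourier A ξ‖ₑ ^ r)) := by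
    intro ξ
    have h1 := tendsto_setIntegral_of_monotone (μ := μ) (f := fun θ => padicKernel ξ θ • A θ)
      (s := fun k : ℕ => (padicLattice p n k : Set (Fin n → ℚ_[p])))
      (fun k => measurableSet_padicLattice _) hmono
      (integrable_padicKernel_smul hA ξ).integrableOn
    rw [iUnion_padicLattice, setIntegral_univ] at h1
    have h2 := (ENNReal.continuous_rpow_const (y := r)).tendsto _ |>.comp
      ((continuous_enorm.tendsto _).comp h1)
    refine h2.congr' ?_
    obtain ⟨k₀, hk₀⟩ := Set.mem_iUnion.1
      ((iUnion_padicLattice (p := p) (n := n)).symm ▸ Set.mem_univ ξ)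
    filter_upwards [Filter.eventually_ge_atTop k₀] with k hk
    exact (Set.indicator_of_mem (hmono hk hk₀) (fun ξ => ‖B k ξ‖ₑ ^ r)).symm
  calc ∫⁻ ξ, ‖padicFourier A ξ‖ₑ ^ r ∂μ
      = ∫⁻ ξ, Filter.liminf (fun k => F k ξ) Filter.atTop ∂μ :=
        lintegral_congr fun ξ => (hlim ξ).liminf_eq.symm
    _ ≤ Filter.liminf (fun k => ∫⁻ ξ, F k ξ ∂μ) Filter.atTop := lintegral_liminf_le hFmeas
    _ ≤ _ := by
        refine Filter.liminf_le_of_le (by isBoundedDefault) fun b hb => ?_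
        obtain ⟨k, hk⟩ := hb.exists
        refine hk.trans ?_
        rw [lintegral_indicator (measurableSet_padicLattice _)]
        exact setLIntegral_enorm_rpow_le hqr hq2 hA k

/-- `L¹ ∩ L² ⊆ L^q` for `1 ≤ q ≤ 2`. -/
theorem lintegral_enorm_rpow_ne_top {α E : Type*} {m : MeasurableSpace α} {μ : Measure α}
    [NormedAddCommGroup E] {f : α → E} {s : ℝ} (hs1 : 1 ≤ s) (hs2 : s ≤ 2) (h1 : MemLp f 1 μ)
    (h2 : MemLp f 2 μ) : ∫⁻ x, ‖f x‖ₑ ^ s ∂μ ≠ ∞ := by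
  have e1 : ∫⁻ x, ‖f x‖ₑ ∂μ < ∞ := by
    have := h1.2
    rwa [eLpNorm_one_eq_lintegral_enorm] at this
  have e2 : ∫⁻ x, ‖f x‖ₑ ^ (2 : ℝ) ∂μ < ∞ := by
    have := lintegral_rpow_enorm_lt_top_of_eLpNorm_lt_top two_ne_zero ENNReal.ofNat_ne_top h2.2
    simpa using this
  refine ne_top_of_le_ne_top (ENNReal.add_lt_top.2 ⟨e1, e2⟩).ne ?_
  rw [← lintegral_add_left' h1.1.enorm]
  refine lintegral_mono fun x => ?_
  -- Pointwise, the power `s` is at most the first power where the norm is at most one, and at most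
  -- the square elsewhere.
  rcases le_total ‖f x‖ₑ 1 with h | h
  · refine le_add_right ?_
    simpa using ENNReal.rpow_le_rpow_of_exponent_ge h hs1
  · exact le_add_left (ENNReal.rpow_le_rpow_of_exponent_le h hs2)

end PadicFourier

theorem theorem4p1 {p : ℕ} [Fact p.Prime] (n : ℕ)
    {H : Type*} [NormedAddCommGroup H] [InnerProductSpace ℂ H] [CompleteSpace H]
    [TopologicalSpace.SeparableSpace H]
    (q : ℝ) [Fact (1 ≤ q)] (hq : q ≤ 2)
    (A : (Fin n → ℚ_[p]) → SchattenClass H q)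
    (hA1 : MemLp A 1 (padicHaar p n)) (hA2 : MemLp A 2 (padicHaar p n)) :
    (∀ ξ : Fin n → ℚ_[p], Integrable (fun θ => padicKernel ξ θ • A θ) (padicHaar p n)) ∧
    (1 < q → MemLp (padicFourier A) (ENNReal.ofReal (q / (q - 1))) (padicHaar p n) ∧
      ∫⁻ ξ, ‖padicFourier A ξ‖ₑ ^ (q / (q - 1)) ∂(padicHaar p n) ≤
        (∫⁻ θ, ‖A θ‖ₑ ^ q ∂(padicHaar p n)) ^ (q / (q - 1) / q)) ∧
    (q = 1 → MemLp (padicFourier A) ∞ (padicHaar p n) ∧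
      ⨆ ξ, ‖padicFourier A ξ‖ₑ ≤ ∫⁻ θ, ‖A θ‖ₑ ∂(padicHaar p n)) := by
  have hA : Integrable A (padicHaar p n) := memLp_one_iff_integrable.1 hA1
  have hmeas : AEStronglyMeasurable (padicFourier A) (padicHaar p n) :=
    (continuous_integral_padicKernel_smul hA).aestronglyMeasurable
  have hq1 : 1 ≤ q := Fact.out
  refine ⟨integrable_padicKernel_smul hA, fun hq1' => ?_, fun _ => ?_⟩
  · have hqr : q.HolderConjugate (q / (q - 1)) := Real.HolderConjugate.conjExponent hq1'
    have hr0 : 0 < q / (q - 1) := hqr.symm.pos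
    have h := lintegral_enorm_padicFourier_rpow_le hqr hq hA
    refine ⟨⟨hmeas, ?_⟩, h⟩
    refine (eLpNorm_lt_top_iff_lintegral_rpow_enorm_lt_top (by simpa using hr0)
      ENNReal.ofReal_ne_top).2 ?_
    rw [ENNReal.toReal_ofReal hr0.le]
    refine h.trans_lt (ENNReal.rpow_lt_top_of_nonneg (by positivity) ?_)
    exact lintegral_enorm_rpow_ne_top hq1 hq hA1 hA2
  · refine ⟨⟨hmeas, ?_⟩, iSup_le (enorm_padicFourier_le A)⟩
    rw [eLpNorm_exponent_top]
    refine (eLpNormEssSup_le_of_ae_enorm_bound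
      (Filter.Eventually.of_forall (enorm_padicFourier_le A))).trans_lt ?_
    exact hA.2
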